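/- Conventions. Let $\mathbb K$ be a field. An arrangement $(\mathcal A,V)$ is a finite set $\mathcal A$ of linear hyperplanes in a finite-dimensional $\mathbb K$-vector space $V$; $\Phi_\ell$ denotes the empty arrangement in a space of dimension $\ell\ge 0$. For $H\in\mathcal A$ put $\mathcal A'=\mathcal A\setminus\{H\}$ (an arrangement in $V$) and $\mathcal A^H=\{H\cap H'\mid H'\in\mathcal A\setminus\{H\}\}$ (an arrangement in $H$). The product of $(\mathcal A_1,V_1)$ and $(\mathcal A_2,V_2)$ is the arrangement $$\mathcal A_1\times\mathcal A_2=\{H_1\oplus V_2\mid H_1\in\mathcal A_1\}\cup\{V_1\oplus H_2\mid H_2\in\mathcal A_2\}$$ in $V_1\oplus V_2$. Let $L(\mathcal A)$ be the set of all intersections of elements of $\mathcal A$ (with $V$ as the empty intersection), ordered by reverse inclusion, let $\mu(X)=\mu(V,X)$ be its Möbius function, and let $\chi(\mathcal A,t)=\sum_{X\in L(\mathcal A)}\mu(X)\,t^{\dim X}\in\mathbb Z[t]$ be the characteristic polynomial. Let $S=S(V^*)$ be the symmetric algebra of $V^*$, let $Q(\mathcal A)=\prod_{H\in\mathcal A}\alpha_H\in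 S$ with $\alpha_H\in V^*$, $\ker\alpha_H=H$, and let $D(\mathcal A)=\{\theta\in\operatorname{Der}_{\mathbb K}(S)\mid\theta(Q(\mathcal A))\in Q(\mathcal A)S\}$. The arrangement $\mathcal A$ is free if $D(\mathcal A)$ is a free $S$-module. It is free with exponents the multiset $\exp\mathcal A=\{b_1,\dots,b_\ell\}$ if $D(\mathcal A)$ has an $S$-basis $\theta_1,\dots,\theta_\ell$ such that $\theta_i$ maps $V^*$ into the homogeneous component $S_{b_i}$ for each $i$. An arrangement $\mathcal A$ in $V$ is additionally free if there is a chain $\emptyset=\mathcal A_0\subset\mathcal A_1\subset\dots\subset\mathcal A_n=\mathcal A$ of free arrangements in $V$ with $|\mathcal A_i|=i$ for all $i$, where $n=|\mathcal A|$. The class of stair-free arrangements is the smallest class of arrangements such that (i) $\Phi_\ell$ is stair-free for every $\ell\ge0$; (ii) (addition) if for some $H\in\mathcal A$ the arrangement $\mathcal A'=\mathcal A\setminus\{H\}$ is stair-free, $\mathcal A'$ is free with exponents $\{b_1,\dots,b_{\ell-1},b_\ell-1\}$ and $\mathcal A^H$ is free with exponents $\{b_1,\dots,b_{\ell-1}\}$,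 then $\mathcal A$ is stair-free; (iii) (division) if for some $H\in\mathcal A$ the restriction $\mathcal A^H$ is stair-free and $\chi(\mathcal A^H,t)$ divides $\chi(\mathcal A,t)$ in $\mathbb Z[t]$, then $\mathcal A$ is stair-free. Proposition. Let $(\mathcal A_1,V_1)$ and $(\mathcal A_2,V_2)$ be two arrangements over $\mathbb K$. Then $(\mathcal A_1\times\mathcal A_2,V_1\oplus V_2)$ is stair-free if and only if both $\mathcal A_1$ and $\mathcal A_2$ are stair-free, and it is additionally free if and only if both $\mathcal A_1$ and $\mathcal A_2$ are additionally free. -/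

import Mathlib

noncomputable section

universe u v

/-- A (central) hyperplane arrangement in the `K`-vector space `V`: a finite set of linear
hyperplanes of `V`, a linear hyperplane being the kernel of a nonzero linear form. -/
@[ext]
structure Arrangement (K : Type u) [Field K] (V : Type v) [AddCommGroup V] [Module K V] where
  hyperplanes : Finset (Submodule K V)
  exists_form : ∀ H ∈ hyperplanes, ∃ α : Module.Dual K V, α ≠ 0 ∧ H = LinearMap.ker α

namespace Arrangement

section Basic

variable {K : Type u} [Field K] {V : Type v} [AddCommGroup V] [Module K V]

/-- The empty arrangement in `V`. -/
def empty (K : Type u) [Field K] (V : Type v) [AddCommGroup V] [Module K V] :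
    Arrangement K V where
  hyperplanes := ∅
  exists_form := by simp

open Classical in
/-- The deletion `A \ {H}`. -/
def deletion (A : Arrangement K V) (H : Submodule K V) : Arrangement K V where
  hyperplanes := A.hyperplanes.erase H
  exists_form := fun H' hH' => A.exists_form H' (Finset.mem_of_mem_erase hH')

open Classical in
/-- The restriction of `A` to a subspace `X`: the arrangement in the vector space `X` consisting of
the `X ∩ H` for those `H ∈ A` that do not contain `X`. -/
def restriction (A : Arrangement K V) (X : Submodule K V) : Arrangement K X where
  hyperplanes := (A.hyperplanes.filter fun H => ¬ X ≤ H).image fun H => H.comap X.subtype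
  exists_form := by
    intro Y hY
    obtain ⟨H, hH, rfl⟩ := Finset.mem_image.1 hY
    obtain ⟨hHA, hXH⟩ := Finset.mem_filter.1 hH
    obtain ⟨α, -, rfl⟩ := A.exists_form H hHA
    refine ⟨α.comp X.subtype, fun h0 => hXH fun x hx => ?_, (LinearMap.ker_comp _ _).symm⟩
    exact LinearMap.congr_fun h0 ⟨x, hx⟩

open Classical in
/-- The product arrangement in `V ⊕ W`: it consists of the `H₁ ⊕ W` with `H₁ ∈ A` and of the
`V ⊕ H₂` with `H₂ ∈ B`. -/
def prod {W : Type*} [AddCommGroup W] [Module K W] (A : Arrangement K V) (B : Arrangement K W) :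
    Arrangement K (V × W) where
  hyperplanes := (A.hyperplanes.image fun H => H.prod ⊤) ∪ (B.hyperplanes.image fun H => .prod ⊤ H)
  exists_form := by
    intro Y hY
    rcases Finset.mem_union.1 hY with hY | hY
    · obtain ⟨H, hH, rfl⟩ := Finset.mem_image.1 hY
      obtain ⟨α, h0, rfl⟩ := A.exists_form H hH
      refine ⟨α.comp (LinearMap.fst K V W), fun h => h0 ?_, ?_⟩
      · ext x
        exact LinearMap.congr_fun h (x, 0)
      · ext x
        simp [Submodule.mem_prod]
    · obtain ⟨H, hH, rfl⟩ := Finset.mem_image.1 hY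
      obtain ⟨α, h0, rfl⟩ := B.exists_form H hH
      refine ⟨α.comp (LinearMap.snd K V W), fun h => h0 ?_, ?_⟩
      · ext x
        exact LinearMap.congr_fun h (0, x)
      · ext x
        simp [Submodule.mem_prod]

/-! ### The intersection lattice and the characteristic polynomial -/

open Classical in
/-- The set `L(A)` of all intersections of elements of `A` (the empty intersection being `V`),
ordered by reverse inclusion. -/
def lattice (A : Arrangement K V) : Finset (Submodule K V)ᵒᵈ :=
  A.hyperplanes.powerset.image fun s => OrderDual.toDual (s.inf id)

/-- `V` as an element of `L(A)`. -/
def wholeSpace (A : Arrangement K V) : A.lattice :=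
  ⟨OrderDual.toDual ⊤, Finset.mem_image.2 ⟨∅, by simp, by simp⟩⟩

open Classical in
instance (A : Arrangement K V) : LocallyFiniteOrder A.lattice :=
  Fintype.toLocallyFiniteOrder

open Classical in
/-- The Möbius function `μ(X) = μ(V, X)` of `L(A)`. -/
def moebius (A : Arrangement K V) (X : A.lattice) : ℤ :=
  IncidenceAlgebra.mu ℤ A.wholeSpace X

/-- The characteristic polynomial `χ(A, t) = ∑_{X ∈ L(A)} μ(X) t ^ dim X`. -/
def charPoly (A : Arrangement K V) : Polynomial ℤ :=
  ∑ X : A.lattice, Polynomial.C (A.moebius X) *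
    Polynomial.X ^ Module.finrank K (OrderDual.ofDual X.1 : Submodule K V)

/-! ### Derivations and freeness -/

/-- The symmetric algebra `S = S(V*)` of the dual space. -/
abbrev Sym (K : Type u) [Field K] (V : Type v) [AddCommGroup V] [Module K V] : Type (max u v) :=
  SymmetricAlgebra K (Module.Dual K V)

/-- A chosen linear form `α_H` with kernel `H`. -/
def form (A : Arrangement K V) (H : A.hyperplanes) : Module.Dual K V :=
  (A.exists_form H.1 H.2).choose

/-- The defining polynomial `Q(A)`, the product of the `α_H`. -/
def definingPoly (A : Arrangement K V) : Sym K V :=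
  ∏ H : A.hyperplanes, SymmetricAlgebra.ι K (Module.Dual K V) (A.form H)

/-- The `S`-module `D(A)` of the `K`-derivations `θ` of `S` with `θ(Q(A)) ∈ Q(A) S`. -/
def derivations (A : Arrangement K V) :
    Submodule (Sym K V) (Derivation K (Sym K V) (Sym K V)) where
  carrier := {θ | A.definingPoly ∣ θ A.definingPoly}
  add_mem' := fun {a b} ha hb => by
    simpa using dvd_add ha hb
  zero_mem' := by simp
  smul_mem' := fun c θ hθ => by
    simpa using hθ.mul_left c

/-- `A` is free if `D(A)` is a free `S`-module. -/
def IsFree (A : Arrangement K V) : Prop :=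
  Module.Free (Sym K V) A.derivations

/-- The homogeneous component `S_d` of `S`, spanned by the products of `d` linear forms. -/
def homogeneousPart (K : Type u) [Field K] (V : Type v) [AddCommGroup V] [Module K V] (d : ℕ) :
    Submodule K (Sym K V) :=
  LinearMap.range (SymmetricAlgebra.ι K (Module.Dual K V)) ^ d

/-- The derivation `θ` of `S` is homogeneous of polynomial degree `d`: it maps every linear form
into `S_d`. -/
def IsHomogeneousDer (θ : Derivation K (Sym K V) (Sym K V)) (d : ℕ) : Prop :=
  ∀ α : Module.Dual K V, θ (SymmetricAlgebra.ι K (Module.Dual K V) α) ∈ homogeneousPart K V d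

/-- `A` is free with exponents `e`: the module `D(A)` has a basis of homogeneous derivations,
and `e` is the multiset of their polynomial degrees. -/
def HasExponents (A : Arrangement K V) (e : Multiset ℕ) : Prop :=
  ∃ (n : ℕ) (θ : Module.Basis (Fin n) (Sym K V) A.derivations) (d : Fin n → ℕ),
    (∀ i, IsHomogeneousDer (θ i : Derivation K (Sym K V) (Sym K V)) (d i)) ∧
      e = Finset.univ.val.map d

/-- `A` is additionally free: there is a chain `∅ = F 0 ⊂ F 1 ⊂ ⋯ ⊂ F n = A` of free
arrangements in `V` with `|F i| = i`, where `n = |A|`. -/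
def AdditionallyFree (A : Arrangement K V) : Prop :=
  ∃ F : ℕ → Arrangement K V,
    F 0 = empty K V ∧ F A.hyperplanes.card = A ∧
      (∀ i < A.hyperplanes.card, (F i).hyperplanes ⊂ (F (i + 1)).hyperplanes) ∧
      ∀ i ≤ A.hyperplanes.card, (F i).IsFree ∧ (F i).hyperplanes.card = i

end Basic

/-- The class of stair-free arrangements: the smallest class that contains the empty arrangements
and is closed under the following two constructions.
* Addition: if `H ∈ A`, the deletion `A'` is in the class, `A'` is free with exponents
  `{b₁, …, b_{ℓ-1}, c}` and the restriction of `A` to `H` is free with exponents `{b₁, …, b_{ℓ-1}}`,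
  then `A` is in the class.
* Division: if `H ∈ A`, the restriction of `A` to `H` is in the class and its characteristic
  polynomial divides that of `A`, then `A` is in the class. -/
inductive StairFree {K : Type u} [Field K] :
    ∀ {V : Type v} [AddCommGroup V] [Module K V], Arrangement K V → Prop
  | empty (V : Type v) [AddCommGroup V] [Module K V] : StairFree (Arrangement.empty K V)
  | addition {V : Type v} [AddCommGroup V] [Module K V] (A : Arrangement K V)
      (H : Submodule K V) (hH : H ∈ A.hyperplanes) (b : Multiset ℕ) (c : ℕ)
      (hA' : StairFree (A.deletion H)) (hexp' : (A.deletion H).HasExponents (c ::ₘ b))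
      (hexp'' : (A.restriction H).HasExponents b) : StairFree A
  | division {V : Type v} [AddCommGroup V] [Module K V] (A : Arrangement K V)
      (H : Submodule K V) (hH : H ∈ A.hyperplanes)
      (hA'' : StairFree (A.restriction H))
      (hdvd : (A.restriction H).charPoly ∣ A.charPoly) : StairFree A

end Arrangement

end

/-! Every hyperplane of `A₁ × A₂` comes from exactly one factor. Deleting it, or restricting to it,
changes that factor alone, the restriction being a product only up to a linear isomorphism. Both
equivalences are therefore inductions along the construction of an arrangement, once the data of
each step are known to split. The characteristic polynomial is multiplicative (`charPoly_prod`), the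
exponents of a product are the union of those of the factors (`HasExponents.prod`), and a product is
free exactly if both factors are (`isFree_prod_iff`).

The algebra takes place in coordinates, where `D(A)` becomes `logDer`, a graded submodule of a free
module over a polynomial ring. Saito's criterion gives the exponents of a product through a block
diagonal matrix. Conversely, the module of a factor is a retract of that of the product, hence
projective, and a graded projective module over a polynomial ring has a homogeneous basis
(`exists_hasDegrees_of_projective`). Uniqueness of the exponents then allows those of the other
factor to be cancelled.

The delicate case is an addition step in `A₁` multiplied by a stair-free `A₂`, because it requires
exponents of `A₂`. If `A₂` arose by division, that division is carried out in the product instead;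
if it arose by addition, Terao's addition theorem (`HasExponents.addition`) supplies the exponents.
The freeness of arrangements obtained by division is never needed. -/

noncomputable section

namespace Arrangement

open MvPolynomial Module

/-! ### Graded submodules of free modules over a polynomial ring. -/

section Graded

variable {K : Type*} [Field K] {τ κ : Type*}

theorem homogeneousComponent_mul_of_isHomogeneous {g : MvPolynomial τ K} {e : ℕ}
    (hg : g.IsHomogeneous e) (d : ℕ) (f : MvPolynomial τ K) :
    homogeneousComponent d (f * g) =
      (if e ≤ d then homogeneousComponent (d - e) f else 0) * g := by
  have h : ∀ i, homogeneousComponent d (homogeneousComponent i f * g) =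
      if d = i + e then homogeneousComponent i f * g else 0 := fun i =>
    homogeneousComponent_of_mem ((homogeneousComponent_isHomogeneous i f).mul hg)
  conv_lhs => rw [← sum_homogeneousComponent f, Finset.sum_mul, map_sum]
  simp_rw [h]
  split_ifs with hed
  · rw [Finset.sum_congr rfl (g := fun i => if i = d - e then homogeneousComponent i f * g else 0)
      (fun i _ => if_congr (by omega) rfl rfl), Finset.sum_ite_eq']
    split_ifs with hmem
    · rfl
    · rw [homogeneousComponent_eq_zero _ _ (by rw [Finset.mem_range] at hmem; omega), zero_mul]
  · rw [zero_mul]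
    exact Finset.sum_eq_zero fun i _ => if_neg (by omega)

/-- A vector of polynomials is homogeneous of degree `d` if all its entries are. -/
def IsHomogeneousVec (f : κ → MvPolynomial τ K) (d : ℕ) : Prop := ∀ i, (f i).IsHomogeneous d

/-- The homogeneous component of degree `d` of a vector of polynomials. -/
def vecComponent (d : ℕ) : (κ → MvPolynomial τ K) →ₗ[K] (κ → MvPolynomial τ K) :=
  (homogeneousComponent d).compLeft κ

theorem vecComponent_apply (d : ℕ) (f : κ → MvPolynomial τ K) (i : κ) :
    vecComponent d f i = homogeneousComponent d (f i) := rfl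

theorem isHomogeneousVec_vecComponent (d : ℕ) (f : κ → MvPolynomial τ K) :
    IsHomogeneousVec (vecComponent d f) d := fun i => homogeneousComponent_isHomogeneous d (f i)

theorem IsHomogeneousVec.vecComponent_self {f : κ → MvPolynomial τ K} {d : ℕ}
    (hf : IsHomogeneousVec f d) : vecComponent d f = f :=
  funext fun i => homogeneousComponent_eq_self (hf i)

theorem vecComponent_smul {g : κ → MvPolynomial τ K} {e : ℕ} (hg : IsHomogeneousVec g e)
    (d : ℕ) (c : MvPolynomial τ K) :
    vecComponent d (c • g) = (if e ≤ d then homogeneousComponent (d - e) c else 0) • g :=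
  funext fun i => homogeneousComponent_mul_of_isHomogeneous (hg i) d c

theorem exists_sum_vecComponent [Finite κ] (f : κ → MvPolynomial τ K) :
    ∃ N, ∑ d ∈ Finset.range N, vecComponent d f = f := by
  have := Fintype.ofFinite κ
  refine ⟨Finset.univ.sup (fun i => (f i).totalDegree) + 1, funext fun i => ?_⟩
  rw [Finset.sum_apply]
  conv_rhs => rw [← sum_homogeneousComponent (f i)]
  refine (Finset.sum_subset ?_ fun d _ hd => ?_).symm
  · intro d hd
    have := Finset.le_sup (f := fun i => (f i).totalDegree) (Finset.mem_univ i)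
    simp only [Finset.mem_range] at hd ⊢
    omega
  · exact homogeneousComponent_eq_zero _ _ (by simpa using hd)

/-- The submodule `M` of a free module over a polynomial ring has a homogeneous basis, whose
degrees form the multiset `e`. -/
def HasDegrees (M : Submodule (MvPolynomial τ K) (κ → MvPolynomial τ K)) (e : Multiset ℕ) : Prop :=
  ∃ (n : ℕ) (θ : Basis (Fin n) (MvPolynomial τ K) M) (d : Fin n → ℕ),
    (∀ i, IsHomogeneousVec (θ i : κ → MvPolynomial τ K) (d i)) ∧ e = Finset.univ.val.map d

theorem HasDegrees.of_basis {M : Submodule (MvPolynomial τ K) (κ → MvPolynomial τ K)}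
    {ι : Type*} [Fintype ι] (θ : Basis ι (MvPolynomial τ K) M) (d : ι → ℕ)
    (h : ∀ i, IsHomogeneousVec (θ i : κ → MvPolynomial τ K) (d i)) :
    HasDegrees M (Finset.univ.val.map d) := by
  refine ⟨Fintype.card ι, θ.reindex (Fintype.equivFin ι), d ∘ (Fintype.equivFin ι).symm,
    fun i => by simpa using h _, ?_⟩
  rw [← Multiset.map_map]
  congr 1
  rw [← Finset.map_univ_equiv (Fintype.equivFin ι).symm, Finset.map_val]
  rfl

/-! ### Projective graded modules have homogeneous bases -/

theorem exists_homogeneous_generators [Finite τ] [Finite κ]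
    (M : Submodule (MvPolynomial τ K) (κ → MvPolynomial τ K))
    (hM : ∀ f ∈ M, ∀ d, vecComponent d f ∈ M) :
    ∃ (n : ℕ) (g : Fin n → κ → MvPolynomial τ K) (d : Fin n → ℕ),
      (∀ i, IsHomogeneousVec (g i) (d i)) ∧ Submodule.span _ (Set.range g) = M := by
  obtain ⟨s, hs⟩ := (isNoetherian_def.1
    (inferInstance : IsNoetherian (MvPolynomial τ K) (κ → MvPolynomial τ K))) M
  choose N hN using exists_sum_vecComponent (K := K) (τ := τ) (κ := κ)
  let T := Σ f : s, Fin (N f)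
  let g : T → κ → MvPolynomial τ K := fun x => vecComponent x.2 x.1
  refine ⟨Fintype.card T, g ∘ (Fintype.equivFin T).symm,
    fun i => ((Fintype.equivFin T).symm i).2,
    fun i => isHomogeneousVec_vecComponent _ _, ?_⟩
  rw [(Fintype.equivFin T).symm.surjective.range_comp]
  refine le_antisymm (Submodule.span_le.2 ?_) ?_
  · rintro _ ⟨x, rfl⟩
    exact hM _ (hs ▸ Submodule.subset_span x.1.2) _
  · conv_lhs => rw [← hs]
    refine Submodule.span_le.2 fun f hf => ?_
    rw [← hN f]
    refine Submodule.sum_mem _ fun d hd => Submodule.subset_span ?_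
    exact ⟨⟨⟨f, hf⟩, ⟨d, Finset.mem_range.1 hd⟩⟩, rfl⟩

/-- In a relation between homogeneous generators whose number is minimal, no coefficient has a
constant term. -/
theorem constantCoeff_eq_zero_of_minimal {n : ℕ} {g : Fin n → κ → MvPolynomial τ K}
    {d : Fin n → ℕ} (hg : ∀ i, IsHomogeneousVec (g i) (d i))
    (hmin : ∀ m < n, ∀ (g' : Fin m → κ → MvPolynomial τ K) (d' : Fin m → ℕ),
      (∀ i, IsHomogeneousVec (g' i) (d' i)) →
        Submodule.span (MvPolynomial τ K) (Set.range g') ≠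
          Submodule.span (MvPolynomial τ K) (Set.range g))
    (c : Fin n → MvPolynomial τ K) (hc : ∑ i, c i • g i = 0) (i : Fin n) :
    constantCoeff (c i) = 0 := by
  by_contra hi
  obtain ⟨m, rfl⟩ : ∃ m, n = m + 1 := ⟨n - 1, by have := i.2; omega⟩
  refine hmin m (by omega) (fun j => g (i.succAbove j)) (fun j => d (i.succAbove j))
    (fun j => hg _) (le_antisymm (Submodule.span_mono ?_) (Submodule.span_le.2 ?_))
  · rintro _ ⟨j, rfl⟩
    exact ⟨_, rfl⟩
  -- In degree `d i` the coefficient of `g i` shrinks to its constant term, a unit by `hi`, so `g i`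
  -- is redundant.
  have key := congrArg (vecComponent (d i)) hc
  rw [map_sum, map_zero, Fin.sum_univ_succAbove _ i] at key
  simp_rw [vecComponent_smul (hg _)] at key
  rw [if_pos le_rfl, Nat.sub_self, homogeneousComponent_zero] at key
  have hgi : g i ∈ Submodule.span (MvPolynomial τ K)
      (Set.range fun j => g (i.succAbove j)) := by
    have h1 : (C (coeff 0 (c i)) : MvPolynomial τ K) • g i ∈ Submodule.span (MvPolynomial τ K)
      (Set.range fun j => g (i.succAbove j)) := by
      rw [eq_neg_of_add_eq_zero_left key]
      exact Submodule.neg_mem _ (Submodule.sum_mem _ fun j _ =>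
        Submodule.smul_mem _ _ (Submodule.subset_span ⟨j, rfl⟩))
    have h2 := Submodule.smul_mem _ (C (coeff 0 (c i))⁻¹ : MvPolynomial τ K) h1
    rwa [smul_smul, ← C_mul, ← constantCoeff_eq, inv_mul_cancel₀ hi, C_1, one_smul] at h2
  rintro _ ⟨j, rfl⟩
  obtain rfl | hj := eq_or_ne j i
  · exact hgi
  · obtain ⟨k, rfl⟩ := Fin.exists_succAbove_eq hj
    exact Submodule.subset_span ⟨k, rfl⟩

/-- A surjection from a free module onto a projective module over a Noetherian domain is injective
if the coefficients of all relations lie in a proper ideal. -/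
theorem linearIndependent_of_forall_mem {R : Type*} [CommRing R] [IsDomain R] [IsNoetherianRing R]
    {M : Type*} [AddCommGroup M] [Module R M] [Module.Projective R M] {ι : Type*} [Finite ι]
    {I : Ideal R} (hI : I ≠ ⊤) (g : ι → M) (hspan : Submodule.span R (Set.range g) = ⊤)
    (hrel : ∀ c : ι →₀ R, Finsupp.linearCombination R g c = 0 → ∀ i, c i ∈ I) :
    LinearIndependent R g := by
  set f := Finsupp.linearCombination R g with hf
  have hsurj : Function.Surjective f := by
    rw [← LinearMap.range_eq_top, hf, Finsupp.range_linearCombination, hspan]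
  obtain ⟨s, hs⟩ := Module.projective_lifting_property f LinearMap.id hsurj
  -- The section `s` makes `p = id - s ∘ f` a projection onto the kernel. A relation `c` equals `p
  -- c`, the combination of the `p (single i 1)` with the coefficients `c i`, which lie in `I`.
  have hN : LinearMap.ker f ≤ I • LinearMap.ker f := by
    intro c hc
    let p : (ι →₀ R) →ₗ[R] (ι →₀ R) := LinearMap.id - s.comp f
    have hp : ∀ x, p x ∈ LinearMap.ker f := fun x => by
      have := LinearMap.congr_fun hs (f x)
      simp only [LinearMap.comp_apply, LinearMap.id_apply] at this
      simp [p, this]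
    have hc' : p c = c := by simp [p, LinearMap.mem_ker.1 hc]
    have hsum : p c = c.sum fun i r => r • p (Finsupp.single i 1) := by
      conv_lhs => rw [← Finsupp.sum_single c]
      rw [map_finsuppSum]
      exact Finsupp.sum_congr fun i _ => by rw [← map_smul, Finsupp.smul_single_one]
    rw [← hc', hsum]
    exact Submodule.sum_mem _ fun i _ => Submodule.smul_mem_smul (hrel c hc i) (hp _)
  -- Nakayama's lemma: some `r` congruent to 1 modulo `I` kills the kernel. As `I` is proper, `r ≠
  -- 0`, and a free module over a domain has no torsion.
  obtain ⟨r, hr, hr0⟩ := Submodule.exists_sub_one_mem_and_smul_eq_zero_of_fg_of_le_smul I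
    (LinearMap.ker f) (IsNoetherian.noetherian _) hN
  have hrne : r ≠ 0 := by
    rintro rfl
    exact hI ((Ideal.eq_top_iff_one _).2 (by simpa using I.neg_mem hr))
  refine linearIndependent_iff.2 fun c hc => ?_
  exact (smul_eq_zero.1 (hr0 c hc)).resolve_left hrne

/-- A graded submodule of a free module of finite rank over a polynomial ring over a field has a
homogeneous basis if it is projective. -/
theorem exists_hasDegrees_of_projective [Finite τ] [Finite κ]
    (M : Submodule (MvPolynomial τ K) (κ → MvPolynomial τ K))
    (hM : ∀ f ∈ M, ∀ d, vecComponent d f ∈ M) [Module.Projective (MvPolynomial τ K) M] :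
    ∃ e, HasDegrees M e := by
  classical
  have hex := exists_homogeneous_generators M hM
  -- `n` is the least number of homogeneous generators; minimality forces the coefficients of all
  -- relations into the kernel of `constantCoeff`.
  obtain ⟨n, hn⟩ : ∃ n, n = Nat.find hex := ⟨_, rfl⟩
  obtain ⟨g, d, hg, hspan⟩ := hn ▸ Nat.find_spec hex
  have hmem : ∀ i, g i ∈ M := fun i => hspan ▸ Submodule.subset_span ⟨i, rfl⟩
  let g' : Fin n → M := fun i => ⟨g i, hmem i⟩
  have hspan' : Submodule.span (MvPolynomial τ K) (Set.range g') = ⊤ := by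
    apply Submodule.map_injective_of_injective M.injective_subtype
    rw [Submodule.map_span, ← Set.range_comp, Submodule.map_top, Submodule.range_subtype]
    exact hspan
  have hli : LinearIndependent (MvPolynomial τ K) g' := by
    refine linearIndependent_of_forall_mem (I := RingHom.ker (constantCoeff (σ := τ) (R := K)))
      (RingHom.ker_ne_top _) g' hspan' fun c hc i => ?_
    refine constantCoeff_eq_zero_of_minimal hg (fun m hm g'' d'' h1 h2 => ?_) c ?_ i
    · exact Nat.find_min hex (hn ▸ hm) ⟨g'', d'', h1, h2.trans hspan⟩
    · have := congrArg (M.subtype) hc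
      rw [Finsupp.linearCombination_apply, Finsupp.sum_fintype _ _ (by simp)] at this
      simpa [g'] using this
  refine ⟨_, n, Basis.mk hli hspan'.ge, d, fun i => ?_, rfl⟩
  simpa [g'] using hg i

/-! ### Uniqueness of the degrees -/

/-- Taking components of degree `k` in the expansion of `x` leaves `θ i` with a coefficient of
degree `k - d i`, hence with none if `d i > k`. -/
theorem repr_eq_zero_of_lt {M : Submodule (MvPolynomial τ K) (κ → MvPolynomial τ K)}
    {ι : Type*} [Fintype ι] (θ : Basis ι (MvPolynomial τ K) M) {d : ι → ℕ}
    (hθ : ∀ i, IsHomogeneousVec (θ i : κ → MvPolynomial τ K) (d i)) {x : M} {k : ℕ}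
    (hx : IsHomogeneousVec (x : κ → MvPolynomial τ K) k) {i : ι} (hi : k < d i) :
    θ.repr x i = 0 := by
  classical
  have h1 : x = ∑ j, (if d j ≤ k then homogeneousComponent (k - d j) (θ.repr x j) else 0) • θ j := by
    apply Subtype.ext
    conv_lhs => rw [← hx.vecComponent_self, ← θ.sum_repr x]
    simp only [Submodule.coe_sum, Submodule.coe_smul, map_sum, vecComponent_smul (hθ _)]
  have h2 := congrArg (fun y => θ.repr y i) h1
  simp only [θ.repr_sum_self] at h2
  rw [h2, if_neg (by omega)]

/-- Projection to the coordinates in `T` loses nothing on the span of the `v j`, so they remain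
independent in a free module of rank `T.card`. -/
theorem card_le_card_of_repr_eq_zero {R M : Type*} [CommRing R] [Nontrivial R] [AddCommGroup M]
    [Module R M] {ι κ : Type*} [Fintype κ] (θ : Basis ι R M) (T : Finset ι)
    {v : κ → M} (hv : LinearIndependent R v) (h : ∀ j, ∀ i ∉ T, θ.repr (v j) i = 0) :
    Fintype.card κ ≤ T.card := by
  let f : M →ₗ[R] (T → R) := LinearMap.pi fun i => (Finsupp.lapply (i : ι)).comp θ.repr.toLinearMap
  have hf : LinearIndependent R (f ∘ v) := by
    rw [Fintype.linearIndependent_iff] at hv ⊢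
    intro c hc
    apply hv c
    apply θ.repr.injective
    ext i
    by_cases hi : i ∈ T
    · simpa [f] using congrFun hc ⟨i, hi⟩
    · simp [h _ i hi]
  simpa using hf.fintype_card_le_finrank

theorem card_filter_le {n : ℕ} (d : Fin n → ℕ) (k : ℕ) :
    ((Finset.univ.val.map d).filter (· ≤ k)).card = {i | d i ≤ k}.toFinset.card := by
  rw [Multiset.filter_map, Multiset.card_map]
  simp only [Finset.card, Set.toFinset_ofPred, Finset.filter_val]
  rfl

/-- The elements of degree at most `k` of one basis are combinations of those of the other, so their
number is intrinsic. Differences of these numbers are the multiplicities. -/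
theorem HasDegrees.unique {M : Submodule (MvPolynomial τ K) (κ → MvPolynomial τ K)}
    {e₁ e₂ : Multiset ℕ} (h₁ : HasDegrees M e₁) (h₂ : HasDegrees M e₂) : e₁ = e₂ := by
  have key : ∀ {e₁ e₂ : Multiset ℕ}, HasDegrees M e₁ → HasDegrees M e₂ →
      ∀ k, (e₁.filter (· ≤ k)).card ≤ (e₂.filter (· ≤ k)).card := by
    rintro _ _ ⟨n, θ, d, hθ, rfl⟩ ⟨m, η, c, hη, rfl⟩ k
    rw [card_filter_le, card_filter_le, Set.toFinset_card]
    refine card_le_card_of_repr_eq_zero η _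
      (θ.linearIndependent.comp (Subtype.val : {i | d i ≤ k} → Fin n) Subtype.val_injective) ?_
    intro j i hi
    refine repr_eq_zero_of_lt η hη (hθ j) ?_
    have : k < c i := by simpa using hi
    exact lt_of_le_of_lt j.2 this
  have heq : ∀ k, (e₁.filter (· ≤ k)).card = (e₂.filter (· ≤ k)).card := fun k =>
    le_antisymm (key h₁ h₂ k) (key h₂ h₁ k)
  have hcount : ∀ (e : Multiset ℕ) (k : ℕ),
      (e.filter (· ≤ k + 1)).card = (e.filter (· ≤ k)).card + e.count (k + 1) := by
    intro e k
    induction e using Multiset.induction_on with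
    | empty => simp
    | cons a s ih =>
      simp only [Multiset.filter_cons, Multiset.card_add, ih, Multiset.count_cons]
      split_ifs <;> first | omega | (simp; omega)
  have hcount0 : ∀ e : Multiset ℕ, (e.filter (· ≤ 0)).card = e.count 0 := by
    intro e
    rw [← Multiset.countP_eq_card_filter, Multiset.count]
    exact Multiset.countP_congr rfl fun x _ => by simp [eq_comm]
  ext k
  cases k with
  | zero => rw [← hcount0, ← hcount0, heq]
  | succ k =>
    have h1 := hcount e₁ k
    have h2 := hcount e₂ k
    have h3 := heq k
    have h4 := heq (k + 1)
    omega

end Graded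

/-! ### Logarithmic derivations in coordinates. -/

section LogDer

variable {K : Type*} [Field K] {σ τ ι : Type*} [Fintype σ]

/-- The value on the linear form with coefficients `a` of the derivation with coefficients `f`. -/
def contract (a : σ → K) : (σ → MvPolynomial τ K) →ₗ[MvPolynomial τ K] MvPolynomial τ K :=
  ∑ i, (C (a i) : MvPolynomial τ K) • LinearMap.proj i

theorem contract_apply (a : σ → K) (f : σ → MvPolynomial τ K) :
    contract a f = ∑ i, C (a i) * f i := by
  simp [contract]

/-- The linear form with coefficients `a`. -/
def linForm (a : σ → K) : MvPolynomial σ K := contract a X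

theorem linForm_eq (a : σ → K) : linForm a = ∑ i, C (a i) * X i := contract_apply a X

theorem contract_smul_left (c : K) (a : σ → K) (f : σ → MvPolynomial τ K) :
    contract (c • a) f = C c * contract a f := by
  simp [contract_apply, Finset.mul_sum, mul_assoc]

theorem linForm_smul (c : K) (a : σ → K) : linForm (c • a) = C c * linForm a :=
  contract_smul_left c a X

theorem isHomogeneous_linForm (a : σ → K) : (linForm a).IsHomogeneous 1 := by
  rw [linForm_eq]
  exact IsHomogeneous.sum _ _ _ fun i _ => isHomogeneous_C_mul_X _ _

theorem coeff_linForm (a : σ → K) (j : σ) : coeff (Finsupp.single j 1) (linForm a) = a j := by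
  classical
  rw [linForm_eq, coeff_sum, Finset.sum_eq_single j]
  · simp
  · intro i _ hij
    rw [coeff_C_mul, coeff_X, if_neg, mul_zero]
    rwa [Finsupp.single_left_inj one_ne_zero]
  · simp

theorem linForm_injective : Function.Injective (linForm : (σ → K) → MvPolynomial σ K) :=
  fun a b h => funext fun j => by rw [← coeff_linForm a, h, coeff_linForm]

theorem linForm_ne_zero {a : σ → K} (ha : a ≠ 0) : linForm a ≠ 0 := by
  obtain ⟨j, hj⟩ := Function.ne_iff.1 ha
  intro h
  exact hj (by rw [← coeff_linForm a, h]; simp)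

theorem prime_linForm {a : σ → K} (ha : a ≠ 0) : Prime (linForm a) := by
  rw [← irreducible_iff_prime]
  refine irreducible_of_totalDegree_eq_one
    ((isHomogeneous_linForm a).totalDegree (linForm_ne_zero ha)) fun x hx => ?_
  obtain ⟨j, hj⟩ := Function.ne_iff.1 ha
  refine isUnit_iff_ne_zero.2 fun h0 => hj ?_
  have := hx (Finsupp.single j 1)
  rw [coeff_linForm, h0, zero_dvd_iff] at this
  exact this

theorem exists_eq_smul_of_linForm_dvd {a b : σ → K} (h : linForm a ∣ linForm b) :
    ∃ c : K, b = c • a := by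
  obtain ⟨q, hq⟩ := h
  have hb := congrArg (homogeneousComponent 1) hq
  rw [homogeneousComponent_eq_self (isHomogeneous_linForm b), mul_comm,
    homogeneousComponent_mul_of_isHomogeneous (isHomogeneous_linForm a), if_pos le_rfl,
    Nat.sub_self, homogeneousComponent_zero, ← linForm_smul] at hb
  exact ⟨_, linForm_injective hb⟩

/-- The module of derivations that are logarithmic along the hyperplanes with normals in `s`. -/
def logDer (s : Set (σ → K)) : Submodule (MvPolynomial σ K) (σ → MvPolynomial σ K) where
  carrier := {f | ∀ a ∈ s, linForm a ∣ contract a f}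
  add_mem' := fun hf hg a ha => by
    rw [map_add]
    exact dvd_add (hf a ha) (hg a ha)
  zero_mem' := fun a _ => by simp
  smul_mem' := fun c f hf a ha => by
    rw [map_smul]
    exact (hf a ha).mul_left c

theorem mem_logDer {s : Set (σ → K)} {f : σ → MvPolynomial σ K} :
    f ∈ logDer s ↔ ∀ a ∈ s, linForm a ∣ contract a f := Iff.rfl

/-- Hence `logDer` depends only on the lines spanned by the normals: neither scaling nor repetition
matters. -/
theorem logDer_le_of_proportional {s t : Set (σ → K)} (h : ∀ a ∈ s, ∃ b ∈ t, ∃ c : K, a = c • b) :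
    logDer t ≤ logDer s := by
  intro f hf a ha
  obtain ⟨b, hb, c, rfl⟩ := h a ha
  rw [linForm_smul, contract_smul_left]
  exact mul_dvd_mul_left _ (hf b hb)

theorem dvd_homogeneousComponent_of_isHomogeneous {g : MvPolynomial τ K} {e : ℕ}
    (hg : g.IsHomogeneous e) {f : MvPolynomial τ K} (h : g ∣ f) (d : ℕ) :
    g ∣ homogeneousComponent d f := by
  obtain ⟨q, rfl⟩ := h
  rw [mul_comm, homogeneousComponent_mul_of_isHomogeneous hg]
  exact dvd_mul_left _ _

theorem contract_vecComponent (a : σ → K) (d : ℕ) (f : σ → MvPolynomial τ K) :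
    contract a (vecComponent d f) = homogeneousComponent d (contract a f) := by
  simp [contract_apply, vecComponent_apply]

theorem vecComponent_mem_logDer {s : Set (σ → K)} {f : σ → MvPolynomial σ K} (hf : f ∈ logDer s)
    (d : ℕ) : vecComponent d f ∈ logDer s := fun a ha => by
  rw [contract_vecComponent]
  exact dvd_homogeneousComponent_of_isHomogeneous (isHomogeneous_linForm a) (hf a ha) d

theorem exists_hasDegrees_logDer (s : Set (σ → K))
    [Module.Projective (MvPolynomial σ K) (logDer s)] : ∃ e, HasDegrees (logDer s) e :=
  exists_hasDegrees_of_projective _ fun _ hf d => vecComponent_mem_logDer hf d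

/-- The vectors `a i` are nonzero and pairwise not proportional. -/
def PairwiseIndep (a : ι → σ → K) : Prop :=
  (∀ i, a i ≠ 0) ∧ ∀ i j, i ≠ j → ∀ c : K, a j ≠ c • a i

theorem PairwiseIndep.isRelPrime {a : ι → σ → K} (ha : PairwiseIndep a) {i j : ι} (hij : i ≠ j) :
    IsRelPrime (linForm (a i)) (linForm (a j)) :=
  ((prime_linForm (ha.1 i)).irreducible.isRelPrime_iff_not_dvd).2 fun h =>
    let ⟨c, hc⟩ := exists_eq_smul_of_linForm_dvd h
    ha.2 i j hij c hc

theorem PairwiseIndep.prod_dvd {a : ι → σ → K} (ha : PairwiseIndep a) (s : Finset ι)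
    {f : MvPolynomial σ K} (h : ∀ i ∈ s, linForm (a i) ∣ f) : ∏ i ∈ s, linForm (a i) ∣ f :=
  Finset.prod_dvd_of_isRelPrime (fun _ _ _ _ hij => ha.isRelPrime hij) h

variable [Fintype ι]

/-- The product of the linear forms with coefficients `a i`. -/
def formProd (a : ι → σ → K) : MvPolynomial σ K := ∏ i, linForm (a i)

theorem PairwiseIndep.formProd_ne_zero {a : ι → σ → K} (ha : PairwiseIndep a) : formProd a ≠ 0 :=
  Finset.prod_ne_zero_iff.2 fun i _ => linForm_ne_zero (ha.1 i)

theorem isHomogeneous_formProd (a : ι → σ → K) : (formProd a).IsHomogeneous (Fintype.card ι) := by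
  have := IsHomogeneous.prod Finset.univ (fun i => linForm (a i)) (fun _ => 1)
    fun i _ => isHomogeneous_linForm (a i)
  simpa [formProd] using this

/-! ### Saito's criterion -/

variable [DecidableEq σ]

/-- The vector `M a` consists of the values of the rows on the form, all multiples of it. The
adjugate turns it into `det M • a`, and some coordinate of `a` is a unit. -/
theorem linForm_dvd_det {a : σ → K} (ha : a ≠ 0) {M : Matrix σ σ (MvPolynomial σ K)}
    (hM : ∀ j, linForm a ∣ contract a (M j)) : linForm a ∣ M.det := by
  obtain ⟨j, hj⟩ := Function.ne_iff.1 ha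
  have h1 : M.adjugate.mulVec (M.mulVec fun i => C (a i)) = M.det • fun i => C (a i) := by
    rw [Matrix.mulVec_mulVec, Matrix.adjugate_mul, Matrix.smul_mulVec, Matrix.one_mulVec]
  have h2 : linForm a ∣ M.det * C (a j) := by
    have := congrFun h1 j
    rw [Pi.smul_apply, smul_eq_mul] at this
    rw [← this]
    refine Finset.dvd_sum fun i _ => Dvd.dvd.mul_left ?_ _
    convert hM i using 1
    rw [contract_apply]
    exact Finset.sum_congr rfl fun k _ => mul_comm _ _
  have h3 := h2.mul_right (C (a j)⁻¹)
  rwa [mul_assoc, ← C_mul, mul_inv_cancel₀ hj, C_1, mul_one] at h3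

theorem PairwiseIndep.formProd_dvd_det {a : ι → σ → K} (ha : PairwiseIndep a)
    {M : Matrix σ σ (MvPolynomial σ K)} (hM : ∀ j, M j ∈ logDer (Set.range a)) :
    formProd a ∣ M.det :=
  ha.prod_dvd _ fun i _ => linForm_dvd_det (ha.1 i) fun j => hM j _ ⟨i, rfl⟩

/-- Sufficiency in Saito's criterion. By Cramer's rule the coefficients of `f` are quotients by `det
M` of determinants with one row replaced by `f`. Such a determinant has logarithmic rows, hence is a
multiple of `formProd a`, which is `det M` up to a unit. -/
theorem PairwiseIndep.exists_basis_of_associated {a : ι → σ → K} (ha : PairwiseIndep a)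
    {M : Matrix σ σ (MvPolynomial σ K)} (hM : ∀ j, M j ∈ logDer (Set.range a))
    (hdet : Associated M.det (formProd a)) :
    ∃ θ : Basis σ (MvPolynomial σ K) (logDer (Set.range a)),
      ∀ j, (θ j : σ → MvPolynomial σ K) = M j := by
  have hQ := ha.formProd_ne_zero
  have hdet0 : M.det ≠ 0 := fun h => hQ (by rw [h] at hdet; exact (hdet.eq_zero_iff).1 rfl)
  let g : σ → logDer (Set.range a) := fun j => ⟨M j, hM j⟩
  have hli : LinearIndependent (MvPolynomial σ K) g :=
    LinearIndependent.of_comp (Submodule.subtype _)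
      (Matrix.linearIndependent_rows_of_det_ne_zero hdet0)
  have hspan : ⊤ ≤ Submodule.span (MvPolynomial σ K) (Set.range g) := by
    rintro ⟨f, hf⟩ -
    have hq : ∀ j, M.det ∣ Matrix.cramer M.transpose f j := fun j => by
      rw [hdet.dvd_iff_dvd_left, Matrix.cramer_transpose_apply]
      refine ha.formProd_dvd_det fun k => ?_
      obtain rfl | hk := eq_or_ne k j
      · rwa [Matrix.updateRow_self]
      · rw [Matrix.updateRow_ne hk]
        exact hM k
    choose q hq using hq
    have hf' : f = ∑ j, q j • M j := by
      have h1 := Matrix.mulVec_cramer M.transpose f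
      rw [Matrix.det_transpose] at h1
      funext k
      have h2 := congrFun h1 k
      apply mul_left_cancel₀ hdet0
      rw [Pi.smul_apply, smul_eq_mul] at h2
      rw [← h2, Matrix.mulVec, dotProduct, Finset.sum_apply, Finset.mul_sum]
      refine Finset.sum_congr rfl fun j _ => ?_
      rw [hq, Matrix.transpose_apply, Pi.smul_apply, smul_eq_mul]
      ring
    have hf'' : (⟨f, hf⟩ : logDer (Set.range a)) = ∑ j, q j • g j := by
      apply Subtype.ext
      simpa [g] using hf'
    rw [hf'']
    exact Submodule.sum_mem _ fun j _ => Submodule.smul_mem _ _ (Submodule.subset_span ⟨j, rfl⟩)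
  exact ⟨Basis.mk hli hspan, fun j => by simp [g]⟩

/-- A determinant that is a multiple of the determinant of any basis. -/
theorem PairwiseIndep.exists_matrix_det_eq {a : ι → σ → K} (ha : PairwiseIndep a) [DecidableEq ι]
    (i : ι) :
    ∃ N : Matrix σ σ (MvPolynomial σ K), (∀ j, N j ∈ logDer (Set.range a)) ∧
      N.det = formProd a * (∏ k ∈ Finset.univ.erase i, linForm (a k)) ^ (Fintype.card σ - 1) := by
  obtain ⟨j₀, hj₀⟩ := Function.ne_iff.1 (ha.1 i)
  set q := ∏ k ∈ Finset.univ.erase i, linForm (a k)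
  -- Row `j ≠ j₀` is `q` times a constant vector that annihilates the `i`-th form, while `q`
  -- supplies all other forms; row `j₀` is `formProd a` times a unit vector. `P` is unipotent, so
  -- only the factors `u` enter the determinant.
  let w : σ → MvPolynomial σ K := fun j => if j = j₀ then 0 else C (-(a i j / a i j₀))
  let P : Matrix σ σ (MvPolynomial σ K) :=
    1 + Matrix.replicateCol Unit w * Matrix.replicateRow Unit (Pi.single j₀ (1 : MvPolynomial σ K))
  let u : σ → MvPolynomial σ K := fun j => if j = j₀ then formProd a else q
  refine ⟨Matrix.diagonal u * P, fun j => ?_, ?_⟩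
  · have hrow : (Matrix.diagonal u * P) j = u j • (Pi.single j 1 + w j • Pi.single j₀ 1) := by
      funext k
      rw [Matrix.diagonal_mul]
      simp [P, Matrix.mul_apply, Matrix.one_apply, Pi.single_apply, eq_comm]
    have hc : ∀ k, contract (a k) ((Matrix.diagonal u * P) j) =
        u j * (C (a k j) + w j * C (a k j₀)) := by
      intro k
      rw [hrow, map_smul, map_add, map_smul]
      simp [contract_apply, Pi.single_apply]
    rintro _ ⟨k, rfl⟩
    rw [hc]
    by_cases hj : j = j₀
    · simp only [u, if_pos hj]
      exact Dvd.dvd.mul_right (Finset.dvd_prod_of_mem _ (Finset.mem_univ k)) _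
    · obtain rfl | hk := eq_or_ne k i
      · have : (C (a k j) + w j * C (a k j₀) : MvPolynomial σ K) = 0 := by
          simp only [w, if_neg hj]
          rw [← C_mul, ← C_add, neg_mul, div_mul_cancel₀ _ hj₀, add_neg_cancel, C_0]
        rw [this, mul_zero]
        exact dvd_zero _
      · simp only [u, if_neg hj]
        exact Dvd.dvd.mul_right (Finset.dvd_prod_of_mem (fun k => linForm (a k))
          (Finset.mem_erase.2 ⟨hk, Finset.mem_univ k⟩)) _
  · rw [Matrix.det_mul, Matrix.det_diagonal, Matrix.det_one_add_replicateCol_mul_replicateRow]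
    have hw : Pi.single j₀ (1 : MvPolynomial σ K) ⬝ᵥ w = 0 := by simp [w]
    rw [hw, add_zero, mul_one, ← Finset.mul_prod_erase _ _ (Finset.mem_univ j₀)]
    simp only [u, if_true]
    rw [Finset.prod_congr rfl fun j hj => if_neg (Finset.ne_of_mem_erase hj), Finset.prod_const,
      Finset.card_erase_of_mem (Finset.mem_univ _), Finset.card_univ]

theorem det_dvd_det_of_basis {D : Submodule (MvPolynomial σ K) (σ → MvPolynomial σ K)}
    (θ : Basis σ (MvPolynomial σ K) D) {N : Matrix σ σ (MvPolynomial σ K)} (hN : ∀ j, N j ∈ D) :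
    (Matrix.of fun j => (θ j : σ → MvPolynomial σ K)).det ∣ N.det := by
  have : N = Matrix.of (fun j k => θ.repr ⟨N j, hN j⟩ k) *
      Matrix.of fun j => (θ j : σ → MvPolynomial σ K) := by
    ext1 j k
    have h := congrArg Subtype.val (θ.sum_repr ⟨N j, hN j⟩)
    rw [Submodule.coe_sum] at h
    have h2 := congrFun h k
    rw [Finset.sum_apply] at h2
    rw [Matrix.mul_apply]
    exact h2.symm
  rw [this, Matrix.det_mul]
  exact dvd_mul_left _ _

/-- Necessity in Saito's criterion. Write the determinant as `formProd a * D`. By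
`exists_matrix_det_eq`, for each `i` a power of the product of the forms other than the `i`-th is a
multiple of `D`. A prime factor of `D` would thus divide some form, and then, omitting that one, a
second form coprime to it. -/
theorem PairwiseIndep.associated_det {a : ι → σ → K} (ha : PairwiseIndep a)
    (θ : Basis σ (MvPolynomial σ K) (logDer (Set.range a))) :
    Associated (Matrix.of fun j => (θ j : σ → MvPolynomial σ K)).det (formProd a) := by
  classical
  set M := Matrix.of fun j => (θ j : σ → MvPolynomial σ K) with hM
  obtain ⟨D, hD⟩ := ha.formProd_dvd_det (M := M) fun j => (θ j).2
  have hQ := ha.formProd_ne_zero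
  rw [hD]
  suffices hu : IsUnit D from (associated_mul_isUnit_left_iff hu).2 (Associated.refl _)
  cases isEmpty_or_nonempty ι with
  | inl h =>
    have h1 := det_dvd_det_of_basis θ (N := 1) fun j b hb => by
      obtain ⟨i, -⟩ := hb
      exact isEmptyElim i
    rw [← hM, hD, Matrix.det_one] at h1
    exact isUnit_of_dvd_one ((dvd_mul_left _ _).trans h1)
  | inr h =>
    have hdvd : ∀ i, D ∣ (∏ k ∈ Finset.univ.erase i, linForm (a k)) ^ (Fintype.card σ - 1) := by
      intro i
      obtain ⟨N, hN, hdet⟩ := ha.exists_matrix_det_eq i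
      have := det_dvd_det_of_basis θ hN
      rw [← hM, hD, hdet] at this
      exact (mul_dvd_mul_iff_left hQ).1 this
    by_contra hu
    have hD0 : D ≠ 0 := by
      rintro rfl
      obtain ⟨i⟩ := h
      have := zero_dvd_iff.1 (hdvd i)
      exact Finset.prod_ne_zero_iff.2 (fun k _ => linForm_ne_zero (ha.1 k)) (eq_zero_of_pow_eq_zero this)
    obtain ⟨p, hp, hpD⟩ := WfDvdMonoid.exists_irreducible_factor hu hD0
    have hpp := irreducible_iff_prime.1 hp
    have hex : ∀ i, ∃ k ≠ i, p ∣ linForm (a k) := fun i => by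
      obtain ⟨k, hk, hpk⟩ := (hpp.dvd_finsetProd_iff _).1
        (hpp.dvd_of_dvd_pow (hpD.trans (hdvd i)))
      exact ⟨k, Finset.ne_of_mem_erase hk, hpk⟩
    obtain ⟨i⟩ := h
    obtain ⟨k, -, hk⟩ := hex i
    obtain ⟨l, hlk, hl⟩ := hex k
    exact hp.not_isUnit (ha.isRelPrime hlk hl hk)

/-- The module lies between the full free module and its multiple by `formProd a`, so it has full
rank. -/
theorem PairwiseIndep.card_eq_of_basis {a : ι → σ → K} (ha : PairwiseIndep a) {n : ℕ}
    (θ : Basis (Fin n) (MvPolynomial σ K) (logDer (Set.range a))) : n = Fintype.card σ := by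
  apply le_antisymm
  · have := θ.linearIndependent.map' (Submodule.subtype _) (Submodule.ker_subtype _)
    simpa using this.fintype_card_le_finrank
  · let g : σ → logDer (Set.range a) := fun j => ⟨formProd a • Pi.single j 1, by
      rintro _ ⟨i, rfl⟩
      rw [map_smul]
      exact Dvd.dvd.mul_right (Finset.dvd_prod_of_mem (fun i => linForm (a i)) (Finset.mem_univ i)) _⟩
    have hg : LinearIndependent (MvPolynomial σ K) g := by
      refine LinearIndependent.of_comp (Submodule.subtype _) ?_
      have := (Matrix.linearIndependent_rows_of_det_ne_zero
        (A := Matrix.diagonal fun _ : σ => formProd a) (by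
          rw [Matrix.det_diagonal]
          exact Finset.prod_ne_zero_iff.2 fun _ _ => ha.formProd_ne_zero))
      have h2 : ⇑(Submodule.subtype _) ∘ g = (Matrix.diagonal fun _ : σ => formProd a).row := by
        funext j k
        simp [g, Matrix.diagonal_apply, Pi.single_apply, eq_comm]
      rw [h2]
      exact this
    simpa using card_le_card_of_repr_eq_zero θ Finset.univ hg (by simp)

theorem PairwiseIndep.exists_basis_of_hasDegrees {a : ι → σ → K} (ha : PairwiseIndep a)
    {e : Multiset ℕ} (he : HasDegrees (logDer (Set.range a)) e) :
    ∃ (θ : Basis σ (MvPolynomial σ K) (logDer (Set.range a))) (d : σ → ℕ),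
      (∀ j, IsHomogeneousVec (θ j : σ → MvPolynomial σ K) (d j)) ∧ e = Finset.univ.val.map d := by
  obtain ⟨n, θ, d, hθ, rfl⟩ := he
  obtain rfl := ha.card_eq_of_basis θ
  let E := (Fintype.equivFin σ).symm
  refine ⟨θ.reindex E, d ∘ E.symm, fun j => by simpa using hθ _, ?_⟩
  rw [← Multiset.map_map]
  congr 1
  rw [← Finset.map_univ_equiv E.symm, Finset.map_val]
  rfl

theorem isHomogeneous_det {M : Matrix σ σ (MvPolynomial τ K)} {d : σ → ℕ}
    (hM : ∀ j, IsHomogeneousVec (M j) (d j)) : M.det.IsHomogeneous (∑ j, d j) := by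
  rw [← Matrix.det_transpose, Matrix.det_apply]
  refine IsHomogeneous.sum _ _ _ fun π _ => ?_
  have h := IsHomogeneous.prod Finset.univ (fun i => M.transpose (π i) i) d fun i _ => hM i (π i)
  rcases Int.units_eq_one_or (Equiv.Perm.sign π) with hs | hs
  · simpa [hs] using h
  · simpa [hs] using h.neg

/-- Compare degrees in Saito's criterion: the determinant of a homogeneous basis has the sum of the
exponents as its degree. -/
theorem PairwiseIndep.sum_eq_card {a : ι → σ → K} (ha : PairwiseIndep a) {e : Multiset ℕ}
    (he : HasDegrees (logDer (Set.range a)) e) : e.sum = Fintype.card ι := by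
  obtain ⟨θ, d, hθ, rfl⟩ := ha.exists_basis_of_hasDegrees he
  have h1 := isHomogeneous_det (M := Matrix.of fun j => (θ j : σ → MvPolynomial σ K)) hθ
  obtain ⟨u, hu⟩ := ha.associated_det θ
  obtain ⟨c, hc, hcu⟩ := MvPolynomial.isUnit_iff_eq_C_of_isReduced.1 u.isUnit
  rw [hcu] at hu
  have h2 := h1.mul (isHomogeneous_C σ c)
  rw [hu] at h2
  exact h2.inj_right (isHomogeneous_formProd a) ha.formProd_ne_zero

theorem PairwiseIndep.hasDegrees_of_associated {a : ι → σ → K} (ha : PairwiseIndep a)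
    {M : Matrix σ σ (MvPolynomial σ K)} {d : σ → ℕ} (hM : ∀ j, M j ∈ logDer (Set.range a))
    (hd : ∀ j, IsHomogeneousVec (M j) (d j)) (hdet : Associated M.det (formProd a)) :
    HasDegrees (logDer (Set.range a)) (Finset.univ.val.map d) := by
  obtain ⟨θ, hθ⟩ := ha.exists_basis_of_associated hM hdet
  exact HasDegrees.of_basis θ d fun j => by rw [hθ]; exact hd j

end LogDer

/-! ### Logarithmic derivations of a product. -/

section Product

variable {K : Type*} [Field K] {σ σ' τ ι ι' : Type*}

/-- The normals of the hyperplanes of a product arrangement. -/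
def prodFamily (a : ι → σ → K) (b : ι' → σ' → K) : ι ⊕ ι' → σ ⊕ σ' → K :=
  Sum.elim (fun i => Sum.elim (a i) 0) (fun j => Sum.elim 0 (b j))

theorem PairwiseIndep.prod {a : ι → σ → K} {b : ι' → σ' → K} (ha : PairwiseIndep a)
    (hb : PairwiseIndep b) : PairwiseIndep (prodFamily a b) := by
  constructor
  · rintro (i | j) h
    · exact ha.1 i (funext fun k => congrFun h (Sum.inl k))
    · exact hb.1 j (funext fun k => congrFun h (Sum.inr k))
  · rintro (i | i) (j | j) hij c h
    · exact ha.2 i j (fun h => hij (h ▸ rfl)) c (funext fun k => congrFun h (Sum.inl k))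
    · exact hb.1 j (funext fun k => (congrFun h (Sum.inr k)).trans (by simp [prodFamily]))
    · exact ha.1 j (funext fun k => (congrFun h (Sum.inl k)).trans (by simp [prodFamily]))
    · exact hb.2 i j (fun h => hij (h ▸ rfl)) c (funext fun k => congrFun h (Sum.inr k))

variable [Fintype σ] [Fintype σ']

theorem contract_elim (a : σ → K) (b : σ' → K) (f : σ ⊕ σ' → MvPolynomial τ K) :
    contract (Sum.elim a b) f = contract a (f ∘ Sum.inl) + contract b (f ∘ Sum.inr) := by
  simp [contract_apply]

theorem contract_zero_left (f : σ → MvPolynomial τ K) : contract (0 : σ → K) f = 0 := by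
  simp [contract_apply]

theorem dvd_contract_zero (g : MvPolynomial τ K) (a : σ → K) :
    g ∣ contract a (0 : σ → MvPolynomial τ K) := by
  rw [map_zero]
  exact dvd_zero g

theorem map_contract {τ' : Type*} (φ : MvPolynomial τ K →ₐ[K] MvPolynomial τ' K) (a : σ → K)
    (f : σ → MvPolynomial τ K) : φ (contract a f) = contract a (φ ∘ f) := by
  simp [contract_apply, MvPolynomial.algHom_C, MvPolynomial.algebraMap_eq]

theorem contract_prodFamily_inl (a : ι → σ → K) (b : ι' → σ' → K) (i : ι)
    (f : σ ⊕ σ' → MvPolynomial τ K) :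
    contract (prodFamily a b (Sum.inl i)) f = contract (a i) (f ∘ Sum.inl) := by
  rw [prodFamily, Sum.elim_inl, contract_elim, contract_zero_left, add_zero]

theorem contract_prodFamily_inr (a : ι → σ → K) (b : ι' → σ' → K) (j : ι')
    (f : σ ⊕ σ' → MvPolynomial τ K) :
    contract (prodFamily a b (Sum.inr j)) f = contract (b j) (f ∘ Sum.inr) := by
  rw [prodFamily, Sum.elim_inr, contract_elim, contract_zero_left, zero_add]

theorem linForm_prodFamily_inl (a : ι → σ → K) (b : ι' → σ' → K) (i : ι) :
    linForm (prodFamily a b (Sum.inl i)) = rename Sum.inl (linForm (a i)) := by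
  rw [linForm, contract_prodFamily_inl, linForm, map_contract]
  congr 1
  ext j : 1
  simp

theorem linForm_prodFamily_inr (a : ι → σ → K) (b : ι' → σ' → K) (j : ι') :
    linForm (prodFamily a b (Sum.inr j)) = rename Sum.inr (linForm (b j)) := by
  rw [linForm, contract_prodFamily_inr, linForm, map_contract]
  congr 1
  ext j : 1
  simp

theorem mem_logDer_prodFamily {a : ι → σ → K} {b : ι' → σ' → K}
    {f : σ ⊕ σ' → MvPolynomial (σ ⊕ σ') K} :
    f ∈ logDer (Set.range (prodFamily a b)) ↔
      (∀ i, rename Sum.inl (linForm (a i)) ∣ contract (a i) (f ∘ Sum.inl)) ∧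
        ∀ j, rename Sum.inr (linForm (b j)) ∣ contract (b j) (f ∘ Sum.inr) := by
  rw [mem_logDer, Set.forall_mem_range, Sum.forall]
  simp only [contract_prodFamily_inl, contract_prodFamily_inr, linForm_prodFamily_inl,
    linForm_prodFamily_inr]

theorem formProd_prodFamily [Fintype ι] [Fintype ι'] (a : ι → σ → K) (b : ι' → σ' → K) :
    formProd (prodFamily a b) = rename Sum.inl (formProd a) * rename Sum.inr (formProd b) := by
  simp only [formProd, Fintype.prod_sum_type, linForm_prodFamily_inl, linForm_prodFamily_inr,
    map_prod]

theorem rename_linForm_dvd {a : σ → K} {f : σ → MvPolynomial σ K}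
    (h : linForm a ∣ contract a f) (φ : σ → τ) :
    rename φ (linForm a) ∣ contract a (rename φ ∘ f) := by
  rw [← map_contract (rename φ)]
  exact map_dvd _ h

/-- The block diagonal matrix formed from two bases satisfies Saito's criterion, since its
determinant is the product of the two determinants in separate variables. -/
theorem HasDegrees.prod [Fintype ι] [Fintype ι'] {a : ι → σ → K} {b : ι' → σ' → K}
    (ha : PairwiseIndep a) (hb : PairwiseIndep b) {e e' : Multiset ℕ}
    (he : HasDegrees (logDer (Set.range a)) e) (he' : HasDegrees (logDer (Set.range b)) e') :
    HasDegrees (logDer (Set.range (prodFamily a b))) (e + e') := by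
  classical
  obtain ⟨θ, d, hθ, rfl⟩ := ha.exists_basis_of_hasDegrees he
  obtain ⟨η, d', hη, rfl⟩ := hb.exists_basis_of_hasDegrees he'
  set M := Matrix.of fun j => (θ j : σ → MvPolynomial σ K) with hM
  set N := Matrix.of fun j => (η j : σ' → MvPolynomial σ' K) with hN
  have hdet : Associated (Matrix.fromBlocks
      (M.map (rename (R := K) (Sum.inl : σ → σ ⊕ σ'))) 0 0
      (N.map (rename (R := K) (Sum.inr : σ' → σ ⊕ σ')))).det (formProd (prodFamily a b)) := by
    have h1 := (ha.associated_det θ).map (rename (R := K) (Sum.inl : σ → σ ⊕ σ'))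
    have h2 := (hb.associated_det η).map (rename (R := K) (Sum.inr : σ' → σ ⊕ σ'))
    rw [← hM, AlgHom.map_det] at h1
    rw [← hN, AlgHom.map_det] at h2
    rw [Matrix.det_fromBlocks_zero₂₁]
    rw [formProd_prodFamily]
    exact h1.mul_mul h2
  have key := (ha.prod hb).hasDegrees_of_associated (d := Sum.elim d d') ?_ ?_ hdet
  · convert key using 1
    rw [← Finset.univ_disjSum_univ, Finset.val_disjSum, Multiset.disjSum, Multiset.map_add,
      Multiset.map_map, Multiset.map_map]
    rfl
  · rintro (j | j)
    · refine mem_logDer_prodFamily.2 ⟨fun i => ?_, fun i => ?_⟩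
      · exact rename_linForm_dvd ((θ j).2 _ ⟨i, rfl⟩) _
      · exact dvd_contract_zero _ _
    · refine mem_logDer_prodFamily.2 ⟨fun i => ?_, fun i => ?_⟩
      · exact dvd_contract_zero _ _
      · exact rename_linForm_dvd ((η j).2 _ ⟨i, rfl⟩) _
  · rintro (j | j) (k | k)
    · exact (hθ j k).rename_isHomogeneous
    · exact isHomogeneous_zero _ _ _
    · exact isHomogeneous_zero _ _ _
    · exact (hη j k).rename_isHomogeneous

/-- A retract of a projective module along a retraction of the base ring is projective. -/
theorem projective_of_semilinear_retract {A B : Type*} [CommRing A] [CommRing B] {φ : A →+* B}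
    {ψ : B →+* A} (hφψ : ψ.comp φ = RingHom.id A) {N D : Type*} [AddCommGroup N] [Module A N]
    [AddCommGroup D] [Module B D] [Module.Projective B D] (i : N →ₛₗ[φ] D) (r : D →ₛₗ[ψ] N)
    (hri : ∀ x, r (i x) = x) : Module.Projective A N := by
  obtain ⟨s, hs⟩ := (Module.projective_def' (R := B) (P := D)).1 inferInstance
  have hψ : ∀ x, ψ (φ x) = x := RingHom.congr_fun hφψ
  -- The section `s` embeds `D` in a free `B`-module, and `ψ` pushes its coefficients down to `A`;
  -- linearity over `A` uses that `ψ` undoes `φ`.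
  let f : N →ₗ[A] (D →₀ A) :=
    { toFun := fun x => (s (i x)).mapRange ψ (map_zero ψ)
      map_add' := fun x y => by ext; simp
      map_smul' := fun c x => by ext; simp [hψ] }
  have hf : ∀ x, f x = (s (i x)).mapRange ψ (map_zero ψ) := fun _ => rfl
  refine Module.Projective.of_split f (Finsupp.linearCombination A r) (LinearMap.ext fun x => ?_)
  have h1 := LinearMap.congr_fun hs (i x)
  simp only [LinearMap.comp_apply, LinearMap.id_apply] at h1 ⊢
  conv_rhs => rw [← hri x, ← h1]
  rw [Finsupp.linearCombination_apply, Finsupp.linearCombination_apply,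
    hf, Finsupp.sum_of_support_subset _ Finsupp.support_mapRange _ (by simp)]
  simp [Finsupp.sum, map_sum]

/-- Padding by zeros embeds the module of the factor; setting the second variables to zero and
dropping the second components is a retraction. Retracts inherit projectivity directly, whereas
freeness takes the graded argument. -/
theorem projective_logDer_left {a : ι → σ → K} {b : ι' → σ' → K}
    [Module.Projective (MvPolynomial (σ ⊕ σ') K) (logDer (Set.range (prodFamily a b)))] :
    Module.Projective (MvPolynomial σ K) (logDer (Set.range a)) := by
  let φ : MvPolynomial σ K →ₐ[K] MvPolynomial (σ ⊕ σ') K := rename Sum.inl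
  let ψ : MvPolynomial (σ ⊕ σ') K →ₐ[K] MvPolynomial σ K := aeval (Sum.elim X 0)
  have hψ : ∀ p, ψ (φ p) = p := fun p => by
    have : ψ.comp φ = AlgHom.id K _ := by ext i; simp [φ, ψ]
    exact DFunLike.congr_fun this p
  let i : logDer (Set.range a) →ₛₗ[(φ : MvPolynomial σ K →+* MvPolynomial (σ ⊕ σ') K)]
      logDer (Set.range (prodFamily a b)) :=
    { toFun := fun f => ⟨Sum.elim (φ ∘ f) 0, mem_logDer_prodFamily.2
        ⟨fun i => rename_linForm_dvd (f.2 _ ⟨i, rfl⟩) _,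
          fun i => dvd_contract_zero _ _⟩⟩
      map_add' := fun x y => by ext (j | j) <;> simp
      map_smul' := fun c x => by ext (j | j) <;> simp }
  let r : logDer (Set.range (prodFamily a b))
      →ₛₗ[(ψ : MvPolynomial (σ ⊕ σ') K →+* MvPolynomial σ K)] logDer (Set.range a) :=
    { toFun := fun f => ⟨ψ ∘ f.1 ∘ Sum.inl, by
        rintro _ ⟨i, rfl⟩
        rw [← map_contract ψ, ← hψ (linForm (a i))]
        exact map_dvd ψ ((mem_logDer_prodFamily.1 f.2).1 i)⟩
      map_add' := fun x y => by ext j; simp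
      map_smul' := fun c x => by ext j; simp }
  refine projective_of_semilinear_retract (φ := (φ : MvPolynomial σ K →+* MvPolynomial (σ ⊕ σ') K))
    (ψ := (ψ : MvPolynomial (σ ⊕ σ') K →+* MvPolynomial σ K))
    (RingHom.ext hψ) i r fun x => ?_
  ext j : 2
  exact hψ _

end Product

/-! ### The addition theorem in coordinates. -/

section Addition

variable {K : Type*} [Field K] {τ ι κ : Type*}

/-- Restriction of polynomial functions to the hyperplane where the coordinate `none` vanishes. -/
def reduction : MvPolynomial (Option τ) K →ₐ[K] MvPolynomial τ K :=
  aeval fun o => o.elim 0 X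

@[simp]
theorem reduction_X_none : reduction (X none : MvPolynomial (Option τ) K) = 0 := by
  simp [reduction]

@[simp]
theorem reduction_rename_some (p : MvPolynomial τ K) : reduction (rename some p) = p := by
  have : reduction.comp (rename some) = AlgHom.id K (MvPolynomial τ K) := by
    ext i
    simp [reduction]
  exact DFunLike.congr_fun this p

theorem X_none_dvd_sub (p : MvPolynomial (Option τ) K) :
    X none ∣ p - rename some (reduction p) := by
  induction p using MvPolynomial.induction_on with
  | C c => simp [algHom_C]
  | add p q hp hq =>
    rw [map_add, map_add, add_sub_add_comm]
    exact dvd_add hp hq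
  | mul_X p o hp =>
    cases o with
    | none => simp
    | some i =>
      have : reduction (X (some i) : MvPolynomial (Option τ) K) = X i := by simp [reduction]
      rw [map_mul, map_mul, this, rename_X, ← sub_mul]
      exact hp.mul_right _

theorem reduction_eq_zero_iff {p : MvPolynomial (Option τ) K} : reduction p = 0 ↔ X none ∣ p := by
  constructor
  · intro h
    simpa [h] using X_none_dvd_sub p
  · rintro ⟨q, rfl⟩
    rw [map_mul, reduction_X_none, zero_mul]

theorem isHomogeneous_reduction {p : MvPolynomial (Option τ) K} {d : ℕ} (hp : p.IsHomogeneous d) :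
    (reduction p).IsHomogeneous d := by
  have := hp.aeval (fun o : Option τ => (o.elim 0 X : MvPolynomial τ K)) (n := 1) (by
    rintro (_ | i)
    · exact isHomogeneous_zero _ _ _
    · exact isHomogeneous_X _ _)
  simpa [reduction] using this

/-- Restriction of the coefficients of a derivation to a coordinate hyperplane. -/
def restrictVec (f : Option τ → MvPolynomial (Option τ) K) (j : τ) : MvPolynomial τ K :=
  reduction (f (some j))

variable {a : ι → Option τ → K} {a' : κ → τ → K} {π : ι → κ} {c : ι → K}

/-- The normals of the arrangement obtained by adding the hyperplane `X none = 0`. -/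
def addFamily [DecidableEq τ] (a : ι → Option τ → K) (o : Option ι) : Option τ → K :=
  o.elim (Pi.single none 1) a

theorem PairwiseIndep.addFamily [DecidableEq τ] (ha : PairwiseIndep a) (h : ∀ i, a i ∘ some ≠ 0) :
    PairwiseIndep (addFamily a) := by
  constructor
  · rintro (_ | i) h0
    · simpa [Arrangement.addFamily] using congrFun h0 none
    · exact ha.1 i h0
  · rintro (_ | i) (_ | j) hij r hr
    · exact hij rfl
    · exact h j (funext fun k => by simpa [Arrangement.addFamily] using congrFun hr (some k))
    · refine h i (funext fun k => ?_)
      have h1 := congrFun hr none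
      have h2 := congrFun hr (some k)
      simp only [Arrangement.addFamily, Option.elim, Pi.single_apply, Pi.smul_apply, smul_eq_mul,
        if_true, reduceCtorEq, if_false] at h1 h2
      have hr0 : r ≠ 0 := by
        rintro rfl
        simp at h1
      simpa [hr0] using h2.symm
    · exact ha.2 i j (fun h => hij (h ▸ rfl)) r hr

variable [Fintype τ]

theorem contract_option {υ : Type*} (a : Option τ → K) (f : Option τ → MvPolynomial υ K) :
    contract a f = C (a none) * f none + contract (a ∘ some) (f ∘ some) := by
  simp [contract_apply, Fintype.sum_option]

theorem linForm_option (a : Option τ → K) :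
    linForm a = C (a none) * X none + rename some (linForm (a ∘ some)) := by
  rw [linForm, contract_option, linForm, map_contract]
  congr 2
  ext j : 1
  simp

theorem reduction_linForm (a : Option τ → K) : reduction (linForm a) = linForm (a ∘ some) := by
  rw [linForm_option, map_add, map_mul, reduction_X_none, mul_zero, zero_add,
    reduction_rename_some]

theorem linForm_single_none [DecidableEq τ] :
    linForm (Pi.single none 1 : Option τ → K) = X none := by
  simp [linForm_eq, Pi.single_apply]

theorem contract_single_none {υ : Type*} [DecidableEq τ] (f : Option τ → MvPolynomial υ K) :
    contract (Pi.single none 1 : Option τ → K) f = f none := by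
  simp [contract_apply, Pi.single_apply]

theorem linForm_dvd_contract_restrictVec {a : Option τ → K}
    {f : Option τ → MvPolynomial (Option τ) K} (h : linForm a ∣ contract a f)
    (h0 : reduction (f none) = 0) :
    linForm (a ∘ some) ∣ contract (a ∘ some) (restrictVec f) := by
  have h1 := map_dvd reduction h
  rw [reduction_linForm, map_contract, contract_option, Function.comp_apply, h0, mul_zero,
    zero_add] at h1
  exact h1

theorem mem_logDer_addFamily [DecidableEq τ] {f : Option τ → MvPolynomial (Option τ) K} :
    f ∈ logDer (Set.range (addFamily a)) ↔ X none ∣ f none ∧ f ∈ logDer (Set.range a) := by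
  rw [mem_logDer, Set.forall_mem_range, Option.forall, mem_logDer, Set.forall_mem_range]
  simp only [addFamily, Option.elim, linForm_single_none, contract_single_none]

/-- Here and below `a` lists normals of the deletion, in coordinates where the new hyperplane is `X
none = 0`; `a'` lists those of the restriction, and `π` sends a hyperplane to its trace. By `h0` the
derivation is tangent to the new hyperplane, so it restricts. -/
theorem restrictVec_mem (hπ : Function.Surjective π)
    (hc : ∀ i, a i ∘ some = c i • a' (π i)) (hc0 : ∀ i, c i ≠ 0)
    {f : Option τ → MvPolynomial (Option τ) K} (hf : f ∈ logDer (Set.range a))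
    (h0 : reduction (f none) = 0) : restrictVec f ∈ logDer (Set.range a') := by
  refine logDer_le_of_proportional (t := Set.range fun i => a i ∘ some) ?_ ?_
  · rintro _ ⟨k, rfl⟩
    obtain ⟨i, rfl⟩ := hπ k
    exact ⟨_, ⟨i, rfl⟩, (c i)⁻¹, by
      simp only [hc]; rw [smul_smul, inv_mul_cancel₀ (hc0 i), one_smul]⟩
  · rintro _ ⟨i, rfl⟩
    exact linForm_dvd_contract_restrictVec (hf _ ⟨i, rfl⟩) h0

/-- A basis element of `D(A')` of degree at most `r` is not tangent to the new hyperplane, if `r`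
together with the exponents of the restriction are the exponents of `A'`. -/
theorem exists_reduction_ne_zero (hπ : Function.Surjective π) (ha : PairwiseIndep a)
    (ha' : PairwiseIndep a') (hc : ∀ i, a i ∘ some = c i • a' (π i)) (hc0 : ∀ i, c i ≠ 0)
    (θ : Basis (Option τ) (MvPolynomial (Option τ) K) (logDer (Set.range a))) {d : Option τ → ℕ}
    (hθ : ∀ j, IsHomogeneousVec (θ j : Option τ → MvPolynomial (Option τ) K) (d j))
    {r : ℕ} {b : Multiset ℕ} (hd : Finset.univ.val.map d = r ::ₘ b)
    (hb : HasDegrees (logDer (Set.range a')) b) :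
    ∃ k, d k ≤ r ∧ reduction ((θ k : Option τ → MvPolynomial (Option τ) K) none) ≠ 0 := by
  classical
  by_contra! hcon
  obtain ⟨m, φ, e, hφ, rfl⟩ := hb
  let v : {k // d k ≤ r} → logDer (Set.range a') := fun k =>
    ⟨restrictVec (θ k : Option τ → MvPolynomial (Option τ) K),
      restrictVec_mem hπ hc hc0 (θ k).2 (hcon _ k.2)⟩
  -- A relation between the restrictions lifts to a logarithmic `F` divisible by `X none`. This form
  -- is coprime to those of `a`, so the quotient `η` is logarithmic too and the coefficients of `F`
  -- are multiples of `X none`. They do not involve that variable, hence vanish.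
  have hv : LinearIndependent (MvPolynomial τ K) v := by
    rw [Fintype.linearIndependent_iff]
    intro g hg k
    let F : logDer (Set.range a) := ∑ j : {k // d k ≤ r}, rename some (g j) • θ j
    have hF : ∀ o, X none ∣ (F : Option τ → MvPolynomial (Option τ) K) o := by
      intro o
      rw [← reduction_eq_zero_iff]
      simp only [F, Submodule.coe_sum, Finset.sum_apply, Submodule.coe_smul, Pi.smul_apply,
        smul_eq_mul, map_sum, map_mul, reduction_rename_some]
      cases o with
      | none => exact Finset.sum_eq_zero fun j _ => by rw [hcon j j.2, mul_zero]
      | some t =>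
        have h2 := congrFun (congrArg Subtype.val hg) t
        simpa only [Submodule.coe_sum, Finset.sum_apply, Submodule.coe_smul, Pi.smul_apply,
          smul_eq_mul, ZeroMemClass.coe_zero, Pi.zero_apply, v, restrictVec] using h2
    choose η hη using hF
    have hηF : (F : Option τ → MvPolynomial (Option τ) K) = (X none : MvPolynomial (Option τ) K) • η :=
      funext hη
    have hηmem : η ∈ logDer (Set.range a) := by
      rintro _ ⟨i, rfl⟩
      have h1 := F.2 _ ⟨i, rfl⟩
      rw [hηF, map_smul, smul_eq_mul] at h1
      refine IsRelPrime.dvd_of_dvd_mul_left ?_ h1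
      have h2 := (ha.addFamily fun i => ?_).isRelPrime (Option.some_ne_none i)
      · rwa [Arrangement.addFamily, Arrangement.addFamily, Option.elim, Option.elim,
          linForm_single_none] at h2
      · rw [hc]
        exact smul_ne_zero (hc0 i) (ha'.1 _)
    have hF' : F = (X none : MvPolynomial (Option τ) K) • (⟨η, hηmem⟩ : logDer (Set.range a)) :=
      Subtype.ext hηF
    have h1 : θ.repr F k = rename some (g k) := by
      simp only [F, map_sum, map_smul, Basis.repr_self, Finsupp.coe_finsetSum, Finset.sum_apply,
        Finsupp.smul_apply, smul_eq_mul]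
      rw [Finset.sum_eq_single k]
      · simp
      · intro j _ hjk
        rw [Finsupp.single_eq_of_ne (fun h => hjk (Subtype.ext h.symm)), mul_zero]
      · simp
    rw [← reduction_rename_some (g k), ← h1, hF', map_smul, Finsupp.smul_apply, smul_eq_mul,
      map_mul, reduction_X_none, zero_mul]
  -- The independent restrictions of degree at most `r` lie in the span of the `φ j` of degree at
  -- most `r`, of which there is one fewer.
  have hcard := card_le_card_of_repr_eq_zero φ {j | e j ≤ r}.toFinset hv fun k i hi => by
    refine repr_eq_zero_of_lt φ hφ (k := d k) (fun j => isHomogeneous_reduction (hθ k _)) ?_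
    have : r < e i := by simpa using hi
    exact lt_of_le_of_lt k.2 this
  rw [← card_filter_le] at hcard
  have h1 : (Multiset.filter (· ≤ r) (Finset.univ.val.map d)).card =
      (Multiset.filter (· ≤ r) (Finset.univ.val.map e)).card + 1 := by
    rw [hd, Multiset.filter_cons_of_pos (p := (· ≤ r)) _ (le_refl r), Multiset.card_cons]
  rw [Multiset.filter_map, Multiset.card_map] at h1
  rw [Fintype.card_subtype] at hcard
  have h2 : (Finset.univ.filter fun k => d k ≤ r).card =
    (Multiset.filter ((· ≤ r) ∘ d) Finset.univ.val).card := rfl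
  omega

variable [Fintype ι] [Fintype κ] [DecidableEq κ]

/-- The number of elements of `ι` over `k`. -/
def fiberCard (π : ι → κ) (k : κ) : ℕ := (Finset.univ.filter fun i => π i = k).card

theorem sum_fiberCard_sub_one_add (hπ : Function.Surjective π) :
    ∑ k, (fiberCard π k - 1) + Fintype.card κ = Fintype.card ι := by
  have h : Fintype.card κ = ∑ _k : κ, 1 := by simp
  rw [h, ← Finset.sum_add_distrib]
  have h1 : ∀ k, fiberCard π k - 1 + 1 = fiberCard π k := fun k => by
    obtain ⟨i, hi⟩ := hπ k
    have : 0 < fiberCard π k := Finset.card_pos.2 ⟨i, by simpa using hi⟩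
    omega
  simp only [h1]
  rw [← Finset.card_univ (α := ι)]
  exact (Finset.card_eq_sum_card_fiberwise fun _ _ => Finset.mem_univ _).symm

/-- The product of the restricted linear forms, each with its multiplicity minus one. -/
def multProd (π : ι → κ) (a' : κ → τ → K) : MvPolynomial τ K :=
  ∏ k, linForm (a' k) ^ (fiberCard π k - 1)

theorem isHomogeneous_multProd :
    (multProd π a').IsHomogeneous (∑ k, (fiberCard π k - 1)) := by
  refine IsHomogeneous.prod _ _ _ fun k _ => ?_
  simpa using (isHomogeneous_linForm (a' k)).pow (fiberCard π k - 1)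

/-- A derivation in `D(A')` maps the linear form of the deleted hyperplane into the ideal generated
by that form and the product of the restricted forms with multiplicities. -/
theorem multProd_dvd (hπ : Function.Surjective π) (ha : PairwiseIndep a)
    (ha' : PairwiseIndep a') (hc : ∀ i, a i ∘ some = c i • a' (π i)) (hc0 : ∀ i, c i ≠ 0)
    {f : Option τ → MvPolynomial (Option τ) K} (hf : f ∈ logDer (Set.range a)) :
    multProd π a' ∣ reduction (f none) := by
  refine Finset.prod_dvd_of_isRelPrime
    (fun k _ l _ hkl => (ha'.isRelPrime hkl).pow) fun k _ => ?_
  -- `y` extends the restricted form by zero, so every form over `k` is a combination of `y` and `X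
  -- none`. Each of them therefore divides `linForm y * f none - X none * contract y f`. On `X none
  -- = 0` one factor `y` cancels, which explains the exponent `fiberCard π k - 1`.
  let y : Option τ → K := fun o => o.elim 0 (a' k)
  have hy : y ∘ some = a' k := rfl
  have hdvd : ∏ i with π i = k, linForm (a i) ∣ linForm y * f none - X none * contract y f := by
    refine ha.prod_dvd _ fun i hi => ?_
    have hik : π i = k := by simpa using hi
    have h1 : linForm (a i) = C (c i) * linForm y + C (a i none) * X none := by
      rw [linForm_option, hc, linForm_option y, hy, hik, linForm_smul, map_mul, rename_C]
      simp [y]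
      ring
    have h2 : contract (a i) f = C (c i) * contract y f + C (a i none) * f none := by
      rw [contract_option, hc, contract_option y, hy, hik, contract_smul_left]
      simp [y]
      ring
    have h3 : linForm (a i) ∣ C (c i) * (linForm y * f none - X none * contract y f) := by
      have : C (c i) * (linForm y * f none - X none * contract y f) =
          linForm (a i) * f none - X none * contract (a i) f := by rw [h1, h2]; ring
      rw [this]
      exact dvd_sub (dvd_mul_right _ _) ((hf _ ⟨i, rfl⟩).mul_left _)
    have h4 := h3.mul_left (C (c i)⁻¹)
    rwa [← mul_assoc, ← C_mul, inv_mul_cancel₀ (hc0 i), C_1, one_mul] at h4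
  have h1 := map_dvd reduction hdvd
  rw [map_sub, map_mul, map_mul, reduction_X_none, zero_mul, sub_zero, reduction_linForm, hy,
    map_prod] at h1
  have h2 : linForm (a' k) ^ fiberCard π k ∣ ∏ i with π i = k, reduction (linForm (a i)) := by
    rw [fiberCard, ← Finset.prod_const]
    refine Finset.prod_dvd_prod_of_dvd _ _ fun i hi => ?_
    have hik : π i = k := by simpa using hi
    rw [reduction_linForm, hc, hik, linForm_smul]
    exact dvd_mul_left _ _
  have h3 := h2.trans h1
  have hpos : fiberCard π k = fiberCard π k - 1 + 1 := by
    obtain ⟨i, hi⟩ := hπ k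
    have : 0 < fiberCard π k := Finset.card_pos.2 ⟨i, by simpa using hi⟩
    omega
  rw [hpos, pow_succ'] at h3
  exact (mul_dvd_mul_iff_left (linForm_ne_zero (ha'.1 k))).1 h3

/-- The addition theorem. -/
theorem HasDegrees.addition [DecidableEq τ] (hπ : Function.Surjective π) (ha : PairwiseIndep a)
    (ha' : PairwiseIndep a') (hc : ∀ i, a i ∘ some = c i • a' (π i)) (hc0 : ∀ i, c i ≠ 0)
    {r : ℕ} {b : Multiset ℕ} (hr : HasDegrees (logDer (Set.range a)) (r ::ₘ b))
    (hb : HasDegrees (logDer (Set.range a')) b) :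
    HasDegrees (logDer (Set.range (addFamily a))) ((r + 1) ::ₘ b) := by
  classical
  -- The exponents sum to the numbers of hyperplanes of deletion and restriction; `r` is the
  -- difference, which is also the degree of `multProd`.
  have hdegree : ∑ k, (fiberCard π k - 1) = r := by
    have h1 := ha.sum_eq_card hr
    have h2 := ha'.sum_eq_card hb
    have h3 := sum_fiberCard_sub_one_add hπ
    rw [Multiset.sum_cons] at h1
    omega
  have hB := isHomogeneous_multProd (π := π) (a' := a')
  rw [hdegree] at hB
  obtain ⟨θ, d, hθ, hd⟩ := ha.exists_basis_of_hasDegrees hr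
  obtain ⟨k, hkr, hk⟩ := exists_reduction_ne_zero hπ ha ha' hc hc0 θ hθ hd.symm hb
  have hdvd : ∀ j, multProd π a' ∣
      reduction ((θ j : Option τ → MvPolynomial (Option τ) K) none) := fun j =>
    multProd_dvd hπ ha ha' hc hc0 (θ j).2
  have hom : ∀ j, (reduction ((θ j : Option τ → MvPolynomial (Option τ) K) none)).IsHomogeneous
      (d j) := fun j => isHomogeneous_reduction (hθ j none)
  -- A nonzero multiple of `multProd` of degree at most `r` can only be a constant multiple.
  obtain ⟨u, hu⟩ : ∃ u : K, reduction ((θ k : Option τ → MvPolynomial (Option τ) K) none) =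
      C u * multProd π a' := by
    obtain ⟨q, hq⟩ := hdvd k
    have h1 := congrArg (homogeneousComponent (d k)) hq
    rw [homogeneousComponent_eq_self (hom k), mul_comm,
      homogeneousComponent_mul_of_isHomogeneous hB] at h1
    split_ifs at h1 with hrk
    · rw [le_antisymm hkr hrk, Nat.sub_self, homogeneousComponent_zero] at h1
      exact ⟨_, h1⟩
    · exact absurd (h1.trans (zero_mul _)) hk
  have hu0 : u ≠ 0 := by
    rintro rfl
    exact hk (by rw [hu, C_0, zero_mul])
  have hdk : d k = r := by
    refine (hom k).inj_right ?_ hk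
    rw [hu]
    exact hB.C_mul u
  -- Modulo `X none`, all values `θ j none` are now multiples of `θ k none`. The multiplier is cut
  -- down to its component of degree `d j - d k`, or to 0 if `d j < d k`, so that the new rows stay
  -- homogeneous.
  have hw : ∀ j, ∃ w : MvPolynomial τ K,
      reduction ((θ j : Option τ → MvPolynomial (Option τ) K) none) =
        w * reduction ((θ k : Option τ → MvPolynomial (Option τ) K) none) ∧
      IsHomogeneousVec (rename some w • (θ k : Option τ → MvPolynomial (Option τ) K)) (d j) := by
    intro j
    obtain ⟨q, hq⟩ := hdvd j
    have h1 : reduction ((θ j : Option τ → MvPolynomial (Option τ) K) none) =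
        (C u⁻¹ * q) * reduction ((θ k : Option τ → MvPolynomial (Option τ) K) none) := by
      rw [hu, hq]
      have : (C u⁻¹ * C u : MvPolynomial τ K) = 1 := by rw [← C_mul, inv_mul_cancel₀ hu0, C_1]
      linear_combination (-(multProd π a' * q)) * this
    have h2 := congrArg (homogeneousComponent (d j)) h1
    rw [homogeneousComponent_eq_self (hom j),
      homogeneousComponent_mul_of_isHomogeneous (hom k)] at h2
    refine ⟨_, h2, fun o => ?_⟩
    split_ifs with hle
    · have h3 := ((homogeneousComponent_isHomogeneous (d j - d k) (C u⁻¹ * q)).rename_isHomogeneous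
        (f := some)).mul (hθ k o)
      rwa [Nat.sub_add_cancel hle] at h3
    · simpa using isHomogeneous_zero _ _ _
  choose w hw hwhom using hw
  set M := Matrix.of fun j => (θ j : Option τ → MvPolynomial (Option τ) K) with hM
  -- Subtracting multiples of row `k` makes all other rows tangent to the new hyperplane.
  -- Multiplying row `k` by `X none` does the same for that row, and gives the determinant its
  -- missing factor.
  let M' : Matrix (Option τ) (Option τ) (MvPolynomial (Option τ) K) := fun j =>
    if j = k then M k else M j - rename some (w j) • M k
  have hdet' : M'.det = M.det := by
    refine (Matrix.det_eq_of_forall_row_eq_smul_add_const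
      (fun j => if j = k then 0 else rename some (w j)) k (if_pos rfl) fun i j => ?_).symm
    by_cases hi : i = k
    · simp [M', hi]
    · simp [M', hi]
  have hdet : Associated (M'.updateRow k ((X none : MvPolynomial (Option τ) K) • M k)).det
      (formProd (addFamily a)) := by
    have h1 : M'.updateRow k (M k) = M' := by
      conv_rhs => rw [← Matrix.updateRow_eq_self M' k]
      simp [M']
    rw [Matrix.det_updateRow_smul, h1, hdet', formProd, Fintype.prod_option]
    refine Associated.mul_mul (Associated.of_eq ?_) (ha.associated_det θ)
    rw [addFamily, Option.elim, linForm_single_none]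
  have hfin := (ha.addFamily fun i => ?_).hasDegrees_of_associated
    (d := fun j => if j = k then r + 1 else d j) ?_ ?_ hdet
  · convert hfin using 1
    have huniv := Multiset.cons_erase (Finset.mem_univ_val k)
    rw [← huniv, Multiset.map_cons, hdk, Multiset.cons_inj_right] at hd
    rw [← huniv, Multiset.map_cons, if_pos rfl, hd]
    congr 1
    refine Multiset.map_congr rfl fun j hj => (if_neg ?_).symm
    exact ((Finset.univ.nodup.mem_erase_iff).1 hj).1
  · rw [hc]
    exact smul_ne_zero (hc0 i) (ha'.1 _)
  · intro j
    rw [mem_logDer_addFamily]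
    by_cases hj : j = k
    · rw [hj, Matrix.updateRow_self]
      exact ⟨dvd_mul_right _ _, Submodule.smul_mem _ _ (θ k).2⟩
    · rw [Matrix.updateRow_ne hj]
      simp only [M', if_neg hj]
      refine ⟨?_, Submodule.sub_mem _ (θ j).2 (Submodule.smul_mem _ _ (θ k).2)⟩
      rw [← reduction_eq_zero_iff, Pi.sub_apply, Pi.smul_apply, smul_eq_mul, map_sub, map_mul,
        reduction_rename_some, sub_eq_zero]
      exact hw j
  · intro j
    by_cases hj : j = k
    · rw [hj, Matrix.updateRow_self, if_pos rfl]
      intro o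
      have := (isHomogeneous_X K (none : Option τ)).mul (hθ k o)
      rwa [hdk, add_comm] at this
    · rw [Matrix.updateRow_ne hj, if_neg hj]
      simp only [M', if_neg hj]
      exact fun o => (hθ j o).sub (hwhom j o)

end Addition

/-! ### From the symmetric algebra to polynomials. -/

section Coordinates

theorem exists_basis_of_semilinear {R S M N ι : Type*} [Semiring R] [Semiring S] [AddCommMonoid M]
    [AddCommMonoid N] [Module R M] [Module S N] (e : R ≃+* S) (φ : M ≃+ N)
    (h : ∀ c x, φ (c • x) = e c • φ x) (b : Basis ι R M) :
    ∃ b' : Basis ι S N, ∀ i, b' i = φ (b i) := by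
  let _ : Module R N := Module.compHom N (e : R →+* S)
  let φ' : M ≃ₗ[R] N := { φ with map_smul' := h }
  have he : ∀ (c : R) (x : N), e c • x = c • x := fun _ _ => rfl
  exact ⟨(b.map φ').mapCoeffs e he, fun i =>
    ((b.map φ').mapCoeffs_apply e he i).trans (b.map_apply φ' i)⟩

/-- With `c i = θ (p i)` the sum is `θ (∏ p i)` by the Leibniz rule, so the condition `θ Q ∈ Q S`
splits into one condition per hyperplane. Modulo `p i` only the `i`-th term survives, and its
cofactor is coprime to `p i`. -/
theorem prod_dvd_sum_prod_erase_mul_iff {R ι : Type*} [CommRing R] [IsDomain R]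
    [DecompositionMonoid R] [Fintype ι] [DecidableEq ι] (p c : ι → R)
    (hrel : ∀ i j, i ≠ j → IsRelPrime (p i) (p j)) :
    ∏ i, p i ∣ ∑ i, (∏ j ∈ Finset.univ.erase i, p j) * c i ↔ ∀ i, p i ∣ c i := by
  constructor
  · intro h i
    have h1 := (Finset.dvd_prod_of_mem p (Finset.mem_univ i)).trans h
    rw [← Finset.add_sum_erase _ _ (Finset.mem_univ i)] at h1
    have h2 : p i ∣ ∑ k ∈ Finset.univ.erase i, (∏ j ∈ Finset.univ.erase k, p j) * c k :=
      Finset.dvd_sum fun k hk => Dvd.dvd.mul_right (Finset.dvd_prod_of_mem p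
        (Finset.mem_erase.2 ⟨(Finset.ne_of_mem_erase hk).symm, Finset.mem_univ i⟩)) _
    have h3 := (dvd_add_left h2).1 h1
    refine IsRelPrime.dvd_of_dvd_mul_left ?_ h3
    exact IsRelPrime.prod_right fun j hj => hrel i j (Finset.ne_of_mem_erase hj).symm
  · intro h
    refine Finset.dvd_sum fun i _ => ?_
    rw [← Finset.prod_erase_mul _ _ (Finset.mem_univ i)]
    exact mul_dvd_mul_left _ (h i)

theorem derivation_prod {K R ι : Type*} [CommRing K] [CommRing R] [Algebra K R] [DecidableEq ι]
    (θ : Derivation K R R) (s : Finset ι) (f : ι → R) :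
    θ (∏ i ∈ s, f i) = ∑ i ∈ s, (∏ j ∈ s.erase i, f j) * θ (f i) := by
  induction s using Finset.induction_on with
  | empty => simp
  | insert i s hi ih =>
    rw [Finset.prod_insert hi, Derivation.leibniz, Finset.sum_insert hi, ih,
      Finset.erase_insert hi, add_comm, smul_eq_mul, smul_eq_mul, Finset.mul_sum]
    congr 1
    refine Finset.sum_congr rfl fun j hj => ?_
    have hij : i ≠ j := fun h => hi (h ▸ hj)
    rw [Finset.erase_insert_of_ne hij, Finset.prod_insert (by simp [hi]), mul_assoc]

/-- Transport of derivations along an isomorphism of algebras. -/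
def conjDer {K S R : Type*} [CommRing K] [CommRing S] [CommRing R] [Algebra K S] [Algebra K R]
    (E : S ≃ₐ[K] R) (θ : Derivation K S S) : Derivation K R R :=
  Derivation.mk' (E.toLinearMap ∘ₗ θ.toLinearMap ∘ₗ E.symm.toLinearMap) fun x y => by simp

theorem conjDer_apply {K S R : Type*} [CommRing K] [CommRing S] [CommRing R] [Algebra K S]
    [Algebra K R] (E : S ≃ₐ[K] R) (θ : Derivation K S S) (x : R) :
    conjDer E θ x = E (θ (E.symm x)) := rfl

variable {K : Type*} [Field K] {V : Type*} [AddCommGroup V] [Module K V]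
  {σ : Type*} (b : Basis σ K V)

/-- The vectors `a i` are normals of the hyperplanes of `A` in the coordinates given by `b`. -/
def Represents {ι : Type*} (b : Basis σ K V) (a : ι → σ → K) (A : Arrangement K V) : Prop :=
  ∀ H, H ∈ A.hyperplanes ↔ ∃ i, H = LinearMap.ker (b.constr K (a i))

theorem ker_ne_top_of_mem (A : Arrangement K V) {H : Submodule K V} (hH : H ∈ A.hyperplanes) :
    H ≠ ⊤ := by
  obtain ⟨α, h0, rfl⟩ := A.exists_form H hH
  rwa [Ne, LinearMap.ker_eq_top]

theorem exists_smul_eq_of_ker_le {α β : Dual K V} (h : LinearMap.ker α ≤ LinearMap.ker β) :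
    ∃ c : K, β = c • α := by
  have := mem_span_of_iInf_ker_le_ker (L := fun _ : Unit => α) (K := β) (by simpa using h)
  simp only [Set.range_const, Submodule.mem_span_singleton] at this
  obtain ⟨c, hc⟩ := this
  exact ⟨c, hc.symm⟩

/-- The coordinates of the chosen forms of an arrangement. -/
def normals (A : Arrangement K V) (H : A.hyperplanes) (j : σ) : K := A.form H (b j)

theorem ker_form (A : Arrangement K V) (H : A.hyperplanes) :
    LinearMap.ker (A.form H) = H :=
  (A.exists_form H.1 H.2).choose_spec.2.symm

theorem constr_normals (A : Arrangement K V) (H : A.hyperplanes) :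
    b.constr K (normals b A H) = A.form H :=
  b.constr_self K (A.form H)

theorem represents_normals (A : Arrangement K V) : Represents b (normals b A) A := by
  intro H
  constructor
  · intro hH
    exact ⟨⟨H, hH⟩, by rw [constr_normals, ker_form]⟩
  · rintro ⟨H', rfl⟩
    rw [constr_normals, ker_form]
    exact H'.2

variable {b}

theorem Represents.ne_zero {ι : Type*} {a : ι → σ → K} {A : Arrangement K V}
    (h : Represents b a A) (i : ι) : a i ≠ 0 := by
  intro h0
  refine A.ker_ne_top_of_mem ((h _).2 ⟨i, rfl⟩) ?_
  rw [h0, map_zero, LinearMap.ker_zero]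

/-- A representation of an arrangement by pairwise different hyperplanes. -/
theorem Represents.pairwiseIndep {ι : Type*} {a : ι → σ → K} {A : Arrangement K V}
    (h : Represents b a A)
    (hinj : Function.Injective fun i => LinearMap.ker (b.constr K (a i))) : PairwiseIndep a := by
  refine ⟨h.ne_zero, fun i j hij c hc => hij (hinj ?_)⟩
  have hc0 : c ≠ 0 := by
    rintro rfl
    exact h.ne_zero j (by rw [hc, zero_smul])
  change LinearMap.ker (b.constr K (a i)) = LinearMap.ker (b.constr K (a j))
  rw [hc, map_smul, LinearMap.ker_smul _ _ hc0]

theorem pairwiseIndep_normals (A : Arrangement K V) : PairwiseIndep (normals b A) := by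
  refine (represents_normals b A).pairwiseIndep fun H H' h => ?_
  simp only [constr_normals, ker_form] at h
  exact Subtype.ext h

variable [Fintype σ]

theorem Represents.logDer_le {ι κ : Type*} {a : ι → σ → K} {a' : κ → σ → K}
    {A : Arrangement K V} (h : Represents b a A) (h' : Represents b a' A) :
    logDer (Set.range a) ≤ logDer (Set.range a') := by
  refine logDer_le_of_proportional ?_
  rintro _ ⟨k, rfl⟩
  obtain ⟨i, hi⟩ := (h _).1 ((h' _).2 ⟨k, rfl⟩)
  obtain ⟨c, hc⟩ := exists_smul_eq_of_ker_le hi.ge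
  refine ⟨_, ⟨i, rfl⟩, c, (b.constr K).injective ?_⟩
  rw [hc, map_smul]

theorem Represents.logDer_eq {ι κ : Type*} {a : ι → σ → K} {a' : κ → σ → K}
    {A : Arrangement K V} (h : Represents b a A) (h' : Represents b a' A) :
    logDer (Set.range a) = logDer (Set.range a') :=
  le_antisymm (h.logDer_le h') (h'.logDer_le h)

variable [DecidableEq σ] (b)

/-- The identification of the symmetric algebra with the polynomial ring. -/
def symEquiv : Sym K V ≃ₐ[K] MvPolynomial σ K := SymmetricAlgebra.equivMvPolynomial b.dualBasis

theorem symEquiv_ι (α : Dual K V) :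
    symEquiv b (SymmetricAlgebra.ι K _ α) = linForm (fun j => α (b j)) := by
  conv_lhs => rw [← b.dualBasis.sum_repr α]
  rw [map_sum, map_sum, linForm_eq]
  refine Finset.sum_congr rfl fun j _ => ?_
  rw [map_smul, map_smul, symEquiv, SymmetricAlgebra.equivMvPolynomial_ι_apply, b.dualBasis_repr,
    smul_eq_C_mul]

/-- The coefficients of a derivation in coordinates. -/
def coeffVec : Derivation K (Sym K V) (Sym K V) ≃+ (σ → MvPolynomial σ K) where
  toFun θ j := symEquiv b (θ (SymmetricAlgebra.ι K _ (b.dualBasis j)))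
  invFun f := conjDer (symEquiv b).symm (mkDerivation K f)
  left_inv θ := by
    have h : mkDerivation K
        (fun j => symEquiv b (θ (SymmetricAlgebra.ι K _ (b.dualBasis j)))) =
        conjDer (symEquiv b) θ := by
      refine derivation_ext fun j => ?_
      rw [mkDerivation_X, conjDer_apply, symEquiv, SymmetricAlgebra.equivMvPolynomial_symm_X]
    refine Derivation.ext fun x => ?_
    change (symEquiv b).symm (mkDerivation K _ (symEquiv b x)) = θ x
    rw [h, conjDer_apply]
    simp
  right_inv f := by
    funext j
    change symEquiv b ((symEquiv b).symm (mkDerivation K f (symEquiv b _))) = f j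
    rw [AlgEquiv.apply_symm_apply, symEquiv, SymmetricAlgebra.equivMvPolynomial_ι_apply,
      mkDerivation_X]
  map_add' θ η := by
    funext j
    simp

theorem coeffVec_apply (θ : Derivation K (Sym K V) (Sym K V)) (j : σ) :
    coeffVec b θ j = symEquiv b (θ (SymmetricAlgebra.ι K _ (b.dualBasis j))) := rfl

theorem coeffVec_smul (c : Sym K V) (θ : Derivation K (Sym K V) (Sym K V)) :
    coeffVec b (c • θ) = symEquiv b c • coeffVec b θ := by
  funext j
  simp [coeffVec_apply]

theorem symEquiv_derivation_ι (θ : Derivation K (Sym K V) (Sym K V)) (α : Dual K V) :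
    symEquiv b (θ (SymmetricAlgebra.ι K _ α)) = contract (fun j => α (b j)) (coeffVec b θ) := by
  conv_lhs => rw [← b.dualBasis.sum_repr α]
  simp only [map_sum, map_smul, Derivation.map_smul, contract_apply, coeffVec_apply, b.dualBasis_repr, smul_eq_C_mul]

theorem map_homogeneousPart (d : ℕ) :
    (homogeneousPart K V d).map (symEquiv b).toLinearMap = homogeneousSubmodule σ K d := by
  have h1 : (LinearMap.range (SymmetricAlgebra.ι K (Dual K V))).map (symEquiv b).toLinearMap =
      homogeneousSubmodule σ K 1 := by
    rw [homogeneousSubmodule_one_eq_span_X, LinearMap.range_eq_map, ← b.dualBasis.span_eq,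
      Submodule.map_span, Submodule.map_span, ← Set.range_comp, ← Set.range_comp]
    congr 2
    funext j
    exact SymmetricAlgebra.equivMvPolynomial_ι_apply b.dualBasis j
  rw [homogeneousPart, ← homogeneousSubmodule_one_pow, ← h1]
  exact Submodule.map_pow _ (symEquiv b : Sym K V →ₐ[K] MvPolynomial σ K) d

theorem mem_homogeneousPart_iff (d : ℕ) (x : Sym K V) :
    x ∈ homogeneousPart K V d ↔ (symEquiv b x).IsHomogeneous d := by
  rw [← mem_homogeneousSubmodule, ← map_homogeneousPart b d]
  refine ⟨Submodule.mem_map_of_mem, ?_⟩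
  rintro ⟨y, hy, hyx⟩
  rwa [← (symEquiv b).injective hyx]

theorem isHomogeneousDer_iff (θ : Derivation K (Sym K V) (Sym K V)) (d : ℕ) :
    IsHomogeneousDer θ d ↔ IsHomogeneousVec (coeffVec b θ) d := by
  constructor
  · intro h j
    exact (mem_homogeneousPart_iff b _ _).1 (h _)
  · intro h α
    rw [mem_homogeneousPart_iff b, symEquiv_derivation_ι, contract_apply]
    exact IsHomogeneous.sum _ _ _ fun j _ => (h j).C_mul _

variable {b}

variable (b) in
theorem mem_derivations_iff (A : Arrangement K V) (θ : Derivation K (Sym K V) (Sym K V)) :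
    θ ∈ A.derivations ↔ coeffVec b θ ∈ logDer (Set.range (normals b A)) := by
  classical
  change A.definingPoly ∣ θ A.definingPoly ↔ _
  rw [mem_logDer, Set.forall_mem_range, ← prod_dvd_sum_prod_erase_mul_iff
    (fun H => linForm (normals b A H)) _ fun H H' h => (pairwiseIndep_normals A).isRelPrime h,
    ← map_dvd_iff (symEquiv b), definingPoly, derivation_prod, map_prod, map_sum]
  simp only [map_mul, map_prod, symEquiv_ι, symEquiv_derivation_ι]
  rfl

variable (b) in
/-- The module of logarithmic derivations in coordinates. -/
def derivationsEquiv (A : Arrangement K V) :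
    A.derivations ≃+ logDer (Set.range (normals b A)) where
  toFun θ := ⟨coeffVec b θ.1, (mem_derivations_iff b A _).1 θ.2⟩
  invFun f := ⟨(coeffVec b).symm f.1, (mem_derivations_iff b A _).2 (by simp)⟩
  left_inv θ := by simp
  right_inv f := by simp
  map_add' θ η := by ext; simp

variable (b) in
theorem derivationsEquiv_smul (A : Arrangement K V) (c : Sym K V) (θ : A.derivations) :
    derivationsEquiv b A (c • θ) = symEquiv b c • derivationsEquiv b A θ :=
  Subtype.ext (coeffVec_smul b c θ.1)

variable (b) in
theorem derivationsEquiv_symm_smul (A : Arrangement K V) (c : MvPolynomial σ K)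
    (f : logDer (Set.range (normals b A))) :
    (derivationsEquiv b A).symm (c • f) = (symEquiv b).symm c • (derivationsEquiv b A).symm f := by
  rw [AddEquiv.symm_apply_eq, derivationsEquiv_smul]
  simp

/-- Any normals serve, not only the chosen ones, so `prodFamily` and `addFamily` can be used. -/
theorem Represents.hasExponents_iff {ι : Type*} {a : ι → σ → K} {A : Arrangement K V}
    (h : Represents b a A) {e : Multiset ℕ} :
    A.HasExponents e ↔ HasDegrees (logDer (Set.range a)) e := by
  rw [h.logDer_eq (represents_normals b A)]
  constructor
  · rintro ⟨n, θ, d, hd, he⟩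
    obtain ⟨θ', hθ'⟩ := exists_basis_of_semilinear (symEquiv b : Sym K V ≃+* MvPolynomial σ K)
      (derivationsEquiv b A) (derivationsEquiv_smul b A) θ
    refine ⟨n, θ', d, fun i => ?_, he⟩
    rw [hθ']
    exact (isHomogeneousDer_iff b _ _).1 (hd i)
  · rintro ⟨n, θ, d, hd, he⟩
    obtain ⟨θ', hθ'⟩ := exists_basis_of_semilinear
      ((symEquiv b).symm : MvPolynomial σ K ≃+* Sym K V)
      (derivationsEquiv b A).symm (derivationsEquiv_symm_smul b A) θ
    refine ⟨n, θ', d, fun i => ?_, he⟩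
    rw [hθ', isHomogeneousDer_iff b]
    have : derivationsEquiv b A ((derivationsEquiv b A).symm (θ i)) = θ i := by simp
    have h2 : coeffVec b ((derivationsEquiv b A).symm (θ i)).1 = θ i := congrArg Subtype.val this
    rw [h2]
    exact hd i

theorem Represents.isFree_iff {ι : Type*} {a : ι → σ → K} {A : Arrangement K V}
    (h : Represents b a A) :
    A.IsFree ↔ Module.Free (MvPolynomial σ K) (logDer (Set.range a)) := by
  rw [h.logDer_eq (represents_normals b A)]
  constructor
  · intro hf
    have hf' : Module.Free (Sym K V) A.derivations := hf
    obtain ⟨θ, -⟩ := exists_basis_of_semilinear (symEquiv b : Sym K V ≃+* MvPolynomial σ K)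
      (derivationsEquiv b A) (derivationsEquiv_smul b A) (Module.Free.chooseBasis _ _)
    exact Module.Free.of_basis θ
  · intro hf
    obtain ⟨θ, -⟩ := exists_basis_of_semilinear
      ((symEquiv b).symm : MvPolynomial σ K ≃+* Sym K V)
      (derivationsEquiv b A).symm (derivationsEquiv_symm_smul b A) (Module.Free.chooseBasis _ _)
    exact Module.Free.of_basis θ

end Coordinates

/-! ### Freeness of finite-dimensional arrangements -/

section Free

variable {K : Type*} [Field K] {V : Type*} [AddCommGroup V] [Module K V]

theorem HasExponents.isFree {A : Arrangement K V} {e : Multiset ℕ} (h : A.HasExponents e) :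
    A.IsFree := by
  obtain ⟨n, θ, -⟩ := h
  exact Module.Free.of_basis θ

variable [FiniteDimensional K V]

/-- Freeness says nothing about degrees; the homogeneous basis comes from the result on graded
projective modules. -/
theorem IsFree.exists_hasExponents {A : Arrangement K V} (h : A.IsFree) :
    ∃ e, A.HasExponents e := by
  classical
  let b := Module.finBasis K V
  have hr := represents_normals b A
  have := hr.isFree_iff.1 h
  obtain ⟨e, he⟩ := exists_hasDegrees_logDer (Set.range (normals b A))
  exact ⟨e, hr.hasExponents_iff.2 he⟩

theorem HasExponents.unique {A : Arrangement K V} {e e' : Multiset ℕ} (h : A.HasExponents e)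
    (h' : A.HasExponents e') : e = e' := by
  classical
  have hr := represents_normals (Module.finBasis K V) A
  exact (hr.hasExponents_iff.1 h).unique (hr.hasExponents_iff.1 h')

end Free

/-! ### Transport along linear equivalences. -/

section Maps

variable {K : Type*} [Field K] {V W U : Type*} [AddCommGroup V] [Module K V] [AddCommGroup W]
  [Module K W] [AddCommGroup U] [Module K U]

/-- The linear equivalence `e` maps the hyperplanes of `A` to those of `B`. -/
def IsMap (e : V ≃ₗ[K] W) (A : Arrangement K V) (B : Arrangement K W) : Prop :=
  ∀ H : Submodule K W, H.comap e.toLinearMap ∈ A.hyperplanes ↔ H ∈ B.hyperplanes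

theorem IsMap.refl (A : Arrangement K V) : IsMap (LinearEquiv.refl K V) A A := fun _ => Iff.rfl

theorem IsMap.trans {e : V ≃ₗ[K] W} {f : W ≃ₗ[K] U} {A : Arrangement K V} {B : Arrangement K W}
    {C : Arrangement K U} (h : IsMap e A B) (h' : IsMap f B C) : IsMap (e.trans f) A C :=
  fun H => (h (H.comap f.toLinearMap)).trans (h' H)

theorem comap_symm_comap (e : V ≃ₗ[K] W) (H : Submodule K V) :
    (H.comap e.symm.toLinearMap).comap e.toLinearMap = H := by
  ext x
  simp

theorem comap_comap_symm (e : V ≃ₗ[K] W) (H : Submodule K W) :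
    (H.comap e.toLinearMap).comap e.symm.toLinearMap = H := by
  ext x
  simp

theorem comap_equiv_le_iff (e : V ≃ₗ[K] W) {G H : Submodule K W} :
    G.comap e.toLinearMap ≤ H.comap e.toLinearMap ↔ G ≤ H :=
  ⟨fun h => by
    rw [← comap_comap_symm e G, ← comap_comap_symm e H]
    exact Submodule.comap_mono h, fun h => Submodule.comap_mono h⟩

theorem comap_equiv_injective (e : V ≃ₗ[K] W) :
    Function.Injective (Submodule.comap e.toLinearMap) := fun G H h => by
  rw [← comap_comap_symm e G, h, comap_comap_symm]

theorem IsMap.symm {e : V ≃ₗ[K] W} {A : Arrangement K V} {B : Arrangement K W} (h : IsMap e A B) :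
    IsMap e.symm B A := fun H => by
  rw [← h, comap_symm_comap]

theorem IsMap.represents {σ ι : Type*} {b : Basis σ K V} {a : ι → σ → K} {e : V ≃ₗ[K] W}
    {A : Arrangement K V} {B : Arrangement K W} (h : IsMap e A B) (hr : Represents b a A) :
    Represents (b.map e) a B := by
  have hc : ∀ i, b.constr K (a i) = ((b.map e).constr K (a i)).comp e.toLinearMap := fun i =>
    b.ext fun j => by
      have := (b.map e).constr_basis K (a i) j
      rw [Basis.map_apply] at this
      rw [Basis.constr_basis, LinearMap.comp_apply]
      exact this.symm
  intro H
  rw [← h, hr]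
  refine exists_congr fun i => ?_
  rw [hc, LinearMap.ker_comp]
  exact (comap_equiv_injective e).eq_iff

theorem IsMap.hasExponents [FiniteDimensional K V] {e : V ≃ₗ[K] W} {A : Arrangement K V}
    {B : Arrangement K W} (h : IsMap e A B) {s : Multiset ℕ} (hA : A.HasExponents s) :
    B.HasExponents s := by
  have hr := represents_normals (Module.finBasis K V) A
  exact (h.represents hr).hasExponents_iff.2 (hr.hasExponents_iff.1 hA)

theorem IsMap.isFree [FiniteDimensional K V] {e : V ≃ₗ[K] W} {A : Arrangement K V}
    {B : Arrangement K W} (h : IsMap e A B) (hA : A.IsFree) : B.IsFree :=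
  let ⟨_, hs⟩ := hA.exists_hasExponents
  (h.hasExponents hs).isFree

theorem mem_deletion {A : Arrangement K V} {H G : Submodule K V} :
    G ∈ (A.deletion H).hyperplanes ↔ G ≠ H ∧ G ∈ A.hyperplanes := by
  classical
  exact Finset.mem_erase

theorem mem_restriction {A : Arrangement K V} {X : Submodule K V} {Y : Submodule K X} :
    Y ∈ (A.restriction X).hyperplanes ↔ ∃ G ∈ A.hyperplanes, ¬ X ≤ G ∧ G.comap X.subtype = Y := by
  simp [restriction, and_assoc]

theorem eq_of_le_of_mem {A : Arrangement K V} {G H : Submodule K V} (hG : G ∈ A.hyperplanes)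
    (hH : H ∈ A.hyperplanes) (h : G ≤ H) : G = H := by
  have hH' := A.ker_ne_top_of_mem hH
  obtain ⟨α, hα, rfl⟩ := A.exists_form G hG
  obtain ⟨β, hβ, rfl⟩ := A.exists_form H hH
  obtain ⟨c, rfl⟩ := exists_smul_eq_of_ker_le h
  rw [LinearMap.ker_smul]
  rintro rfl
  exact hβ (zero_smul _ _)

/-- No other hyperplane of `A` contains `H`, so the filter in the restriction discards `H` alone. -/
theorem mem_restriction_of_mem {A : Arrangement K V} {H : Submodule K V} (hH : H ∈ A.hyperplanes)
    {Y : Submodule K H} : Y ∈ (A.restriction H).hyperplanes ↔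
      ∃ G ∈ (A.deletion H).hyperplanes, G.comap H.subtype = Y := by
  simp only [mem_restriction, mem_deletion]
  constructor
  · rintro ⟨G, hG, hle, rfl⟩
    exact ⟨G, ⟨fun h => hle h.ge, hG⟩, rfl⟩
  · rintro ⟨G, ⟨hne, hG⟩, rfl⟩
    exact ⟨G, hG, fun h => hne (eq_of_le_of_mem hH hG h).symm, rfl⟩

theorem IsMap.deletion {e : V ≃ₗ[K] W} {A : Arrangement K V} {B : Arrangement K W}
    (h : IsMap e A B) (H : Submodule K W) :
    IsMap e (A.deletion (H.comap e.toLinearMap)) (B.deletion H) := fun G => by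
  rw [mem_deletion, mem_deletion, h, (comap_equiv_injective e).ne_iff]

theorem isMap_restriction {H : Submodule K W} (f : V ≃ₗ[K] H) {A : Arrangement K V}
    {B : Arrangement K W}
    (h : ∀ Z, Z ∈ A.hyperplanes ↔
      ∃ G ∈ B.hyperplanes, ¬ H ≤ G ∧ G.comap (H.subtype ∘ₗ f.toLinearMap) = Z) :
    IsMap f A (B.restriction H) := fun Y => by
  rw [h, mem_restriction]
  refine exists_congr fun G => and_congr_right fun _ => and_congr_right fun _ => ?_
  rw [Submodule.comap_comp, (comap_equiv_injective f).eq_iff]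

theorem IsMap.restriction {e : V ≃ₗ[K] W} {A : Arrangement K V} {B : Arrangement K W}
    (h : IsMap e A B) (H : Submodule K W) :
    IsMap (e.ofSubmodule' H) (A.restriction (H.comap e.toLinearMap)) (B.restriction H) := by
  refine isMap_restriction _ fun Z => ?_
  rw [mem_restriction]
  constructor
  · rintro ⟨G, hG, hle, rfl⟩
    refine ⟨G.comap e.symm.toLinearMap, (h _).1 (by rwa [comap_symm_comap]), fun hle' => hle ?_, ?_⟩
    · rw [← comap_symm_comap e G]
      exact Submodule.comap_mono hle'
    · ext x
      simp
  · rintro ⟨G, hG, hle, rfl⟩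
    refine ⟨G.comap e.toLinearMap, (h G).2 hG, fun hle' => hle ((comap_equiv_le_iff e).1 hle'), ?_⟩
    ext x
    simp

theorem isMap_empty (e : V ≃ₗ[K] W) {A : Arrangement K V} (h : IsMap e A (empty K W)) :
    A = empty K V := by
  ext H
  rw [← comap_symm_comap e H, h]
  simp [empty]

end Maps

/-! ### Deletion, restriction and freeness of products. -/

section Products

variable {K : Type*} [Field K] {V W U : Type*} [AddCommGroup V] [Module K V] [AddCommGroup W]
  [Module K W] [AddCommGroup U] [Module K U] {A : Arrangement K V} {B : Arrangement K W}

theorem mem_prod {Z : Submodule K (V × W)} : Z ∈ (A.prod B).hyperplanes ↔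
    (∃ H ∈ A.hyperplanes, H.prod ⊤ = Z) ∨ ∃ H ∈ B.hyperplanes, .prod ⊤ H = Z := by
  classical
  simp [prod]

theorem submodule_prod_le_iff {G G' : Submodule K V} {H H' : Submodule K W} :
    G.prod H ≤ G'.prod H' ↔ G ≤ G' ∧ H ≤ H' := by
  constructor
  · intro h
    exact ⟨fun x hx => (h (show (x, 0) ∈ G.prod H from ⟨hx, H.zero_mem⟩)).1,
      fun x hx => (h (show (0, x) ∈ G.prod H from ⟨G.zero_mem, hx⟩)).2⟩
  · rintro ⟨h1, h2⟩
    exact Submodule.prod_mono h1 h2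

theorem submodule_prod_inj {G G' : Submodule K V} {H H' : Submodule K W} :
    G.prod H = G'.prod H' ↔ G = G' ∧ H = H' := by
  simp only [le_antisymm_iff, submodule_prod_le_iff]
  tauto

theorem prod_top_mem {H : Submodule K V} :
    H.prod ⊤ ∈ (A.prod B).hyperplanes ↔ H ∈ A.hyperplanes := by
  rw [mem_prod]
  constructor
  · rintro (⟨G, hG, h⟩ | ⟨G, hG, h⟩)
    · rwa [← (submodule_prod_inj.1 h).1]
    · exact absurd (submodule_prod_inj.1 h).2 (B.ker_ne_top_of_mem hG)
  · exact fun h => Or.inl ⟨H, h, rfl⟩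

theorem top_prod_mem {H : Submodule K W} :
    Submodule.prod ⊤ H ∈ (A.prod B).hyperplanes ↔ H ∈ B.hyperplanes := by
  rw [mem_prod]
  constructor
  · rintro (⟨G, hG, h⟩ | ⟨G, hG, h⟩)
    · exact absurd (submodule_prod_inj.1 h).1 (A.ker_ne_top_of_mem hG)
    · rwa [← (submodule_prod_inj.1 h).2]
  · exact fun h => Or.inr ⟨H, h, rfl⟩

variable (A B) in
theorem isMap_prodComm : IsMap (LinearEquiv.prodComm K V W) (A.prod B) (B.prod A) := by
  intro Z
  have hc : ∀ (G : Submodule K W) (H : Submodule K V),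
      (G.prod H).comap (LinearEquiv.prodComm K V W).toLinearMap = H.prod G := by
    intro G H
    ext x
    simp [Submodule.mem_prod, and_comm]
  simp only [mem_prod, ← (comap_equiv_injective (LinearEquiv.prodComm K V W)).eq_iff (b := Z), hc]
  exact or_comm

theorem deletion_prod_left {H : Submodule K V} (hH : H ∈ A.hyperplanes) :
    (A.prod B).deletion (H.prod ⊤) = (A.deletion H).prod B := by
  ext Z
  simp only [mem_deletion, mem_prod]
  constructor
  · rintro ⟨hne, ⟨G, hG, rfl⟩ | h⟩
    · exact Or.inl ⟨G, ⟨fun h => hne (h ▸ rfl), hG⟩, rfl⟩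
    · exact Or.inr h
  · rintro (⟨G, ⟨hne, hG⟩, rfl⟩ | ⟨G, hG, rfl⟩)
    · exact ⟨fun h => hne (submodule_prod_inj.1 h).1, Or.inl ⟨G, hG, rfl⟩⟩
    · exact ⟨fun h => A.ker_ne_top_of_mem hH (submodule_prod_inj.1 h).1.symm, Or.inr ⟨G, hG, rfl⟩⟩

theorem deletion_prod_right {H : Submodule K W} (hH : H ∈ B.hyperplanes) :
    (A.prod B).deletion (.prod ⊤ H) = A.prod (B.deletion H) := by
  ext Z
  simp only [mem_deletion, mem_prod]
  constructor
  · rintro ⟨hne, h | ⟨G, hG, rfl⟩⟩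
    · exact Or.inl h
    · exact Or.inr ⟨G, ⟨fun h => hne (h ▸ rfl), hG⟩, rfl⟩
  · rintro (⟨G, hG, rfl⟩ | ⟨G, ⟨hne, hG⟩, rfl⟩)
    · exact ⟨fun h => B.ker_ne_top_of_mem hH (submodule_prod_inj.1 h).2.symm, Or.inl ⟨G, hG, rfl⟩⟩
    · exact ⟨fun h => hne (submodule_prod_inj.1 h).2, Or.inr ⟨G, hG, rfl⟩⟩

variable (K V W) in
theorem empty_prod_empty : (empty K V).prod (empty K W) = empty K (V × W) := by
  ext Z
  rw [mem_prod]
  simp [empty]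

theorem eq_empty_of_prod_eq_empty (h : A.prod B = empty K (V × W)) :
    A = empty K V ∧ B = empty K W := by
  constructor
  · ext H
    rw [← prod_top_mem (B := B), h]
    simp [empty]
  · ext H
    rw [← top_prod_mem (A := A), h]
    simp [empty]

/-- The subspace `H ⊕ W` as a product. -/
def prodTopEquiv (H : Submodule K V) : (H × W) ≃ₗ[K] (H.prod (⊤ : Submodule K W)) where
  toFun x := ⟨(x.1, x.2), x.1.2, trivial⟩
  invFun x := (⟨x.1.1, x.2.1⟩, x.1.2)
  map_add' _ _ := rfl
  map_smul' _ _ := rfl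

/-- The hyperplanes of the second factor cut `H ⊕ W` in `H ⊕ G`, so that factor survives intact. -/
theorem isMap_restriction_prod (H : Submodule K V) :
    IsMap (prodTopEquiv (W := W) H) ((A.restriction H).prod B)
      ((A.prod B).restriction (H.prod ⊤)) := by
  have hc : ∀ (G : Submodule K V) (G' : Submodule K W), (G.prod G').comap
      ((H.prod (⊤ : Submodule K W)).subtype ∘ₗ (prodTopEquiv H).toLinearMap) =
        (G.comap H.subtype).prod G' := fun G G' => rfl
  refine isMap_restriction _ fun Z => ?_
  simp only [mem_prod, mem_restriction]
  constructor
  · rintro (⟨_, ⟨G, hG, hle, rfl⟩, rfl⟩ | ⟨G, hG, rfl⟩)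
    · exact ⟨G.prod ⊤, Or.inl ⟨G, hG, rfl⟩, fun h => hle (submodule_prod_le_iff.1 h).1, hc _ _⟩
    · refine ⟨Submodule.prod ⊤ G, Or.inr ⟨G, hG, rfl⟩, fun h => ?_, ?_⟩
      · exact B.ker_ne_top_of_mem hG (top_le_iff.1 (submodule_prod_le_iff.1 h).2)
      · rw [hc, Submodule.comap_top]
  · rintro ⟨_, ⟨G, hG, rfl⟩ | ⟨G, hG, rfl⟩, hle, rfl⟩
    · exact Or.inl ⟨_, ⟨G, hG, fun h => hle (submodule_prod_le_iff.2 ⟨h, le_rfl⟩), rfl⟩,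
        (hc _ _).symm⟩
    · exact Or.inr ⟨G, hG, by rw [hc, Submodule.comap_top]⟩

theorem represents_prod {σ σ' ι ι' : Type*} {b : Basis σ K V} {b' : Basis σ' K W}
    {a : ι → σ → K} {a' : ι' → σ' → K} (h : Represents b a A) (h' : Represents b' a' B) :
    Represents (b.prod b') (prodFamily a a') (A.prod B) := by
  have h1 : ∀ i, (b.prod b').constr K (prodFamily a a' (Sum.inl i)) =
      (b.constr K (a i)).comp (LinearMap.fst K V W) := fun i =>
    (b.prod b').ext fun j => by
      rw [Basis.constr_basis]
      cases j <;> simp [prodFamily]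
  have h2 : ∀ i, (b.prod b').constr K (prodFamily a a' (Sum.inr i)) =
      (b'.constr K (a' i)).comp (LinearMap.snd K V W) := fun i =>
    (b.prod b').ext fun j => by
      rw [Basis.constr_basis]
      cases j <;> simp [prodFamily]
  have h3 : ∀ α : Dual K V, LinearMap.ker (α.comp (LinearMap.fst K V W)) =
      (LinearMap.ker α).prod ⊤ := fun α => by ext; simp [Submodule.mem_prod]
  have h4 : ∀ α : Dual K W, LinearMap.ker (α.comp (LinearMap.snd K V W)) =
      Submodule.prod ⊤ (LinearMap.ker α) := fun α => by ext; simp [Submodule.mem_prod]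
  intro Z
  simp only [mem_prod, Sum.exists, h1, h2, h3, h4, h _, h' _]
  constructor
  · rintro (⟨_, ⟨i, rfl⟩, rfl⟩ | ⟨_, ⟨i, rfl⟩, rfl⟩)
    · exact Or.inl ⟨i, rfl⟩
    · exact Or.inr ⟨i, rfl⟩
  · rintro (⟨i, rfl⟩ | ⟨i, rfl⟩)
    · exact Or.inl ⟨_, ⟨i, rfl⟩, rfl⟩
    · exact Or.inr ⟨_, ⟨i, rfl⟩, rfl⟩

variable {C : Arrangement K U}

theorem IsMap.deletion_left {e : (V × W) ≃ₗ[K] U} (h : IsMap e (A.prod B) C) {H : Submodule K U}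
    {G : Submodule K V} (hG : G ∈ A.hyperplanes) (hGH : G.prod ⊤ = H.comap e.toLinearMap) :
    IsMap e ((A.deletion G).prod B) (C.deletion H) := by
  rw [← deletion_prod_left hG, hGH]
  exact h.deletion H

theorem IsMap.deletion_right {e : (V × W) ≃ₗ[K] U} (h : IsMap e (A.prod B) C) {H : Submodule K U}
    {G : Submodule K W} (hG : G ∈ B.hyperplanes) (hGH : .prod ⊤ G = H.comap e.toLinearMap) :
    IsMap e (A.prod (B.deletion G)) (C.deletion H) := by
  rw [← deletion_prod_right hG, hGH]
  exact h.deletion H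

theorem exists_isMap_restriction_of_eq {X Y : Submodule K V} (hXY : X = Y) {D : Arrangement K W}
    {f : W ≃ₗ[K] X} (hf : IsMap f D (A.restriction X)) :
    ∃ f' : W ≃ₗ[K] Y, IsMap f' D (A.restriction Y) := by
  subst hXY
  exact ⟨f, hf⟩

theorem IsMap.exists_restriction_left {e : (V × W) ≃ₗ[K] U} (h : IsMap e (A.prod B) C)
    {H : Submodule K U} {G : Submodule K V} (hGH : G.prod ⊤ = H.comap e.toLinearMap) :
    ∃ f : (G × W) ≃ₗ[K] H, IsMap f ((A.restriction G).prod B) (C.restriction H) := by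
  obtain ⟨f, hf⟩ := exists_isMap_restriction_of_eq hGH (isMap_restriction_prod (A := A) (B := B) G)
  exact ⟨_, hf.trans (h.restriction H)⟩

theorem IsMap.exists_restriction_right {e : (V × W) ≃ₗ[K] U} (h : IsMap e (A.prod B) C)
    {H : Submodule K U} {G : Submodule K W} (hGH : .prod ⊤ G = H.comap e.toLinearMap) :
    ∃ f : (V × G) ≃ₗ[K] H, IsMap f (A.prod (B.restriction G)) (C.restriction H) := by
  obtain ⟨f, hf⟩ := ((isMap_prodComm B A).trans h).exists_restriction_left (H := H) (G := G) (by
    ext x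
    rw [SetLike.ext_iff] at hGH
    have := hGH x.swap
    simpa [Submodule.mem_prod] using this)
  exact ⟨_, (isMap_prodComm _ _).trans hf⟩

variable [FiniteDimensional K V] [FiniteDimensional K W]

theorem HasExponents.prod {s t : Multiset ℕ} (hA : A.HasExponents s) (hB : B.HasExponents t) :
    (A.prod B).HasExponents (s + t) := by
  have h := represents_normals (Module.finBasis K V) A
  have h' := represents_normals (Module.finBasis K W) B
  exact (represents_prod h h').hasExponents_iff.2 (HasDegrees.prod (pairwiseIndep_normals A)
    (pairwiseIndep_normals B) (h.hasExponents_iff.1 hA) (h'.hasExponents_iff.1 hB))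

/-- Free modules are projective, the factor inherits projectivity as a retract, and the grading then
yields a homogeneous basis. -/
theorem IsFree.exists_hasExponents_left (h : (A.prod B).IsFree) : ∃ e, A.HasExponents e := by
  have hA := represents_normals (Module.finBasis K V) A
  have hB := represents_normals (Module.finBasis K W) B
  have := (represents_prod hA hB).isFree_iff.1 h
  have := projective_logDer_left (a := normals (Module.finBasis K V) A)
    (b := normals (Module.finBasis K W) B)
  obtain ⟨e, he⟩ := exists_hasDegrees_logDer (Set.range (normals (Module.finBasis K V) A))
  exact ⟨e, hA.hasExponents_iff.2 he⟩

theorem IsFree.exists_hasExponents_right (h : (A.prod B).IsFree) : ∃ e, B.HasExponents e :=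
  IsFree.exists_hasExponents_left ((isMap_prodComm A B).isFree h)

theorem isFree_prod_iff : (A.prod B).IsFree ↔ A.IsFree ∧ B.IsFree := by
  constructor
  · intro h
    obtain ⟨e, he⟩ := h.exists_hasExponents_left
    obtain ⟨f, hf⟩ := h.exists_hasExponents_right
    exact ⟨he.isFree, hf.isFree⟩
  · rintro ⟨hA, hB⟩
    obtain ⟨e, he⟩ := hA.exists_hasExponents
    obtain ⟨f, hf⟩ := hB.exists_hasExponents
    exact (he.prod hf).isFree

end Products

/-! ### The addition theorem for arrangements. -/

section AdditionTheorem

variable {K : Type*} [Field K] {V : Type*} [AddCommGroup V] [Module K V]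

/-- In these coordinates `H` is the zero set of the coordinate `none`, as `HasDegrees.addition`
requires. -/
theorem exists_basis_option {H : Submodule K V} {α : Dual K V} (hα : α ≠ 0)
    (hH : H = LinearMap.ker α) {τ : Type*} (bH : Basis τ K H) :
    ∃ b : Basis (Option τ) K V, ∀ i, b (some i) = bH i := by
  obtain ⟨v, hv⟩ : ∃ v, α v ≠ 0 := by
    by_contra! h
    exact hα (LinearMap.ext h)
  have hspan : Submodule.span K (Set.range fun i => (bH i : V)) = H := by
    have := congrArg (Submodule.map H.subtype) bH.span_eq
    rw [Submodule.map_span, ← Set.range_comp, Submodule.map_top, Submodule.range_subtype] at this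
    exact this
  let w : Option τ → V := fun o => o.elim v fun i => bH i
  have hli : LinearIndependent K w := by
    rw [linearIndependent_option]
    refine ⟨bH.linearIndependent.map' H.subtype H.ker_subtype, ?_⟩
    change v ∉ Submodule.span K (Set.range fun i => (bH i : V))
    rw [hspan, hH]
    exact hv
  have htop : ⊤ ≤ Submodule.span K (Set.range w) := by
    intro x _
    have hx : x = (x - (α x / α v) • v) + (α x / α v) • v := by abel
    rw [hx]
    refine Submodule.add_mem _ ?_ (Submodule.smul_mem _ _ (Submodule.subset_span ⟨none, rfl⟩))
    have hxH : x - (α x / α v) • v ∈ H := by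
      rw [hH, LinearMap.mem_ker, map_sub, map_smul, smul_eq_mul, div_mul_cancel₀ _ hv, sub_self]
    rw [← hspan] at hxH
    refine Submodule.span_mono ?_ hxH
    rintro _ ⟨i, rfl⟩
    exact ⟨some i, rfl⟩
  exact ⟨Basis.mk hli htop, fun i => by rw [Basis.mk_apply]; rfl⟩

/-- Terao's addition theorem. -/
theorem HasExponents.addition [FiniteDimensional K V] {A : Arrangement K V} {H : Submodule K V}
    (hH : H ∈ A.hyperplanes) {b : Multiset ℕ} {c : ℕ}
    (h' : (A.deletion H).HasExponents (c ::ₘ b)) (h'' : (A.restriction H).HasExponents b) :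
    A.HasExponents ((c + 1) ::ₘ b) := by
  classical
  obtain ⟨α, hα, hαH⟩ := A.exists_form H hH
  let bH := Module.finBasis K H
  obtain ⟨B, hB⟩ := exists_basis_option hα hαH bH
  have hr' := represents_normals B (A.deletion H)
  have hr'' := represents_normals bH (A.restriction H)
  have hmem : ∀ G : (A.deletion H).hyperplanes,
      G.1.comap H.subtype ∈ (A.restriction H).hyperplanes := fun G =>
    (mem_restriction_of_mem hH).2 ⟨G.1, G.2, rfl⟩
  let π : (A.deletion H).hyperplanes → (A.restriction H).hyperplanes := fun G => ⟨_, hmem G⟩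
  have hπ : Function.Surjective π := by
    rintro ⟨Y, hY⟩
    obtain ⟨G, hG, rfl⟩ := (mem_restriction_of_mem hH).1 hY
    exact ⟨⟨G, hG⟩, rfl⟩
  have hc : ∀ G, ∃ c : K, normals B (A.deletion H) G ∘ some =
      c • normals bH (A.restriction H) (π G) := by
    intro G
    have hle : LinearMap.ker ((A.restriction H).form (π G)) ≤
        LinearMap.ker (((A.deletion H).form G).comp H.subtype) := by
      rw [ker_form, LinearMap.ker_comp, ker_form]
    obtain ⟨c, hc⟩ := exists_smul_eq_of_ker_le hle
    refine ⟨c, funext fun j => ?_⟩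
    have := LinearMap.congr_fun hc (bH j)
    simp only [LinearMap.comp_apply, Submodule.subtype_apply, ← hB] at this
    exact this
  choose c' hc' using hc
  -- A zero factor would make the form of `G` vanish on `H`, forcing `G = H`.
  have hc0 : ∀ G, c' G ≠ 0 := by
    intro G h0
    have h1 : ((A.deletion H).form G).comp H.subtype = 0 := bH.ext fun j => by
      have := congrFun (hc' G) j
      rw [h0, zero_smul] at this
      simpa [normals, hB] using this
    have h2 : H ≤ G := fun x hx => by
      rw [← ker_form (A.deletion H) G]
      exact LinearMap.congr_fun h1 ⟨x, hx⟩
    have h3 := mem_deletion.1 G.2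
    exact h3.1 (eq_of_le_of_mem hH h3.2 h2).symm
  have hrep : Represents B (addFamily (normals B (A.deletion H))) A := by
    have hnone : LinearMap.ker (B.constr K (Pi.single none 1 : Option _ → K)) = H := by
      have h1 : α = α (B none) • B.constr K (Pi.single none 1 : Option _ → K) := by
        refine B.ext fun o => ?_
        rw [LinearMap.smul_apply, Basis.constr_basis]
        cases o with
        | none => simp
        | some j =>
          have : (bH j : V) ∈ LinearMap.ker α := hαH ▸ (bH j).2
          rw [hB, LinearMap.mem_ker.1 this]
          simp
      have h2 : α (B none) ≠ 0 := fun h => hα (by rw [h1, h, zero_smul])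
      exact (LinearMap.ker_smul _ _ h2).symm.trans ((congrArg LinearMap.ker h1.symm).trans hαH.symm)
    intro G
    rw [Option.exists]
    simp only [addFamily, Option.elim, hnone]
    rw [← hr' G, mem_deletion]
    by_cases hG : G = H
    · simp [hG, hH]
    · simp [hG]
  exact hrep.hasExponents_iff.2 (HasDegrees.addition hπ (pairwiseIndep_normals _)
    (pairwiseIndep_normals _) hc' hc0 (hr'.hasExponents_iff.1 h') (hr''.hasExponents_iff.1 h''))

end AdditionTheorem

/-! ### Multiplicativity of the characteristic polynomial. -/

section CharPoly

/-- The recursion for `mu` on an interval involves only strictly smaller intervals with the same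
lower end. -/
theorem mu_orderIso {α β : Type*} [PartialOrder α] [PartialOrder β] [LocallyFiniteOrder α]
    [LocallyFiniteOrder β] [DecidableEq α] [DecidableEq β] (φ : α ≃o β) (a b : α) :
    IncidenceAlgebra.mu ℤ (φ a) (φ b) = IncidenceAlgebra.mu ℤ a b := by
  induction hn : (Finset.Icc a b).card using Nat.strong_induction_on generalizing b with
  | _ n ih =>
    rw [IncidenceAlgebra.mu_apply, IncidenceAlgebra.mu_apply (𝕜 := ℤ) a b]
    simp only [φ.injective.eq_iff]
    split_ifs with hab
    · rfl
    · congr 1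
      refine (Finset.sum_nbij φ ?_ φ.injective.injOn ?_ ?_).symm
      · intro x hx
        simpa using hx
      · intro y hy
        obtain ⟨x, rfl⟩ := φ.surjective y
        exact ⟨x, by simpa using hy, rfl⟩
      · intro x hx
        obtain ⟨h1, h2⟩ := Finset.mem_Ico.1 hx
        refine (ih _ ?_ x rfl).symm
        rw [← hn]
        exact Finset.card_lt_card (Finset.Icc_ssubset_Icc_right (h1.trans h2.le) le_rfl h2)

variable {K : Type*} [Field K] {V W : Type*} [AddCommGroup V] [Module K V] [AddCommGroup W]
  [Module K W]

/-- The subspaces in `L(A)`. -/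
def Flats (A : Arrangement K V) (X : Submodule K V) : Prop := OrderDual.toDual X ∈ A.lattice

theorem flats_iff {A : Arrangement K V} {X : Submodule K V} :
    A.Flats X ↔ ∃ s ⊆ A.hyperplanes, s.inf id = X := by
  rw [Flats, lattice, Finset.mem_image]
  simp only [Finset.mem_powerset]
  rfl

theorem flats_top (A : Arrangement K V) : A.Flats ⊤ := flats_iff.2 ⟨∅, by simp, by simp⟩

theorem Flats.inf {A : Arrangement K V} {H X : Submodule K V} (hX : A.Flats X)
    (hH : H ∈ A.hyperplanes) : A.Flats (H ⊓ X) := by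
  classical
  obtain ⟨s, hs, rfl⟩ := flats_iff.1 hX
  exact flats_iff.2 ⟨insert H s, Finset.insert_subset hH hs, by rw [Finset.inf_insert, id]⟩

theorem Flats.induction {A : Arrangement K V} {P : Submodule K V → Prop} (htop : P ⊤)
    (hinf : ∀ H ∈ A.hyperplanes, ∀ X, P X → P (H ⊓ X)) {X : Submodule K V} (hX : A.Flats X) :
    P X := by
  classical
  obtain ⟨s, hs, rfl⟩ := flats_iff.1 hX
  induction s using Finset.induction_on with
  | empty => simpa using htop
  | insert H s _ ih =>
    rw [Finset.insert_subset_iff] at hs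
    rw [Finset.inf_insert]
    exact hinf H hs.1 _ (ih hs.2 (flats_iff.2 ⟨s, hs.2, rfl⟩))

theorem Flats.comap {e : V ≃ₗ[K] W} {A : Arrangement K V} {B : Arrangement K W} (h : IsMap e A B)
    {X : Submodule K W} (hX : B.Flats X) : A.Flats (X.comap e.toLinearMap) :=
  hX.induction (P := fun X => A.Flats (X.comap e.toLinearMap)) (by simpa using A.flats_top)
    fun H hH X hX => by
      rw [Submodule.comap_inf]
      exact hX.inf ((h H).2 hH)

/-- The order isomorphism of lattices of flats induced by a linear equivalence. -/
def IsMap.latticeIso {e : V ≃ₗ[K] W} {A : Arrangement K V} {B : Arrangement K W}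
    (h : IsMap e A B) : B.lattice ≃o A.lattice where
  toFun X := ⟨OrderDual.toDual ((OrderDual.ofDual X.1).comap e.toLinearMap), Flats.comap h X.2⟩
  invFun X := ⟨OrderDual.toDual ((OrderDual.ofDual X.1).comap e.symm.toLinearMap),
    Flats.comap h.symm X.2⟩
  left_inv _ := Subtype.ext (comap_comap_symm e _)
  right_inv _ := Subtype.ext (comap_symm_comap e _)
  map_rel_iff' := comap_equiv_le_iff e

theorem IsMap.charPoly_eq {e : V ≃ₗ[K] W} {A : Arrangement K V} {B : Arrangement K W}
    (h : IsMap e A B) : B.charPoly = A.charPoly := by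
  rw [charPoly, charPoly, ← h.latticeIso.toEquiv.sum_comp]
  refine Finset.sum_congr rfl fun X _ => ?_
  have h1 : h.latticeIso B.wholeSpace = A.wholeSpace := Subtype.ext (Submodule.comap_top _)
  have h2 : A.moebius (h.latticeIso X) = B.moebius X := by
    rw [moebius, moebius, ← h1, mu_orderIso]
  have h3 : finrank K ↥(OrderDual.ofDual (h.latticeIso X).1 : Submodule K V) =
      finrank K ↥(OrderDual.ofDual X.1 : Submodule K W) :=
    (e.ofSubmodule' (OrderDual.ofDual X.1)).finrank_eq
  change _ = Polynomial.C (A.moebius (h.latticeIso X)) *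
    Polynomial.X ^ finrank K ↥(OrderDual.ofDual (h.latticeIso X).1 : Submodule K V)
  rw [h2, h3]

variable {A : Arrangement K V} {B : Arrangement K W}

theorem Flats.prod {X : Submodule K V} {Y : Submodule K W} (hX : A.Flats X) (hY : B.Flats Y) :
    (A.prod B).Flats (X.prod Y) := by
  refine hX.induction (P := fun X => (A.prod B).Flats (X.prod Y)) ?_ fun H hH X hX => ?_
  · refine hY.induction (P := fun Y => (A.prod B).Flats (Submodule.prod ⊤ Y)) ?_
      fun H hH Y hY => ?_
    · rw [Submodule.prod_top]
      exact flats_top _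
    · have := hY.inf (top_prod_mem (A := A).2 hH)
      rwa [Submodule.prod_inf_prod, top_inf_eq] at this
  · have := hX.inf (prod_top_mem (B := B).2 hH)
    rwa [Submodule.prod_inf_prod, top_inf_eq] at this

theorem Flats.exists_prod {Z : Submodule K (V × W)} (hZ : (A.prod B).Flats Z) :
    ∃ X Y, A.Flats X ∧ B.Flats Y ∧ X.prod Y = Z := by
  refine hZ.induction (P := fun Z => ∃ X Y, A.Flats X ∧ B.Flats Y ∧ X.prod Y = Z) ?_ ?_
  · exact ⟨⊤, ⊤, flats_top _, flats_top _, Submodule.prod_top⟩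
  · rintro H hH _ ⟨X, Y, hX, hY, rfl⟩
    rcases mem_prod.1 hH with ⟨G, hG, rfl⟩ | ⟨G, hG, rfl⟩
    · exact ⟨G ⊓ X, Y, hX.inf hG, hY, by rw [Submodule.prod_inf_prod, top_inf_eq]⟩
    · exact ⟨X, G ⊓ Y, hX, hY.inf hG, by rw [Submodule.prod_inf_prod, top_inf_eq]⟩

variable (A B) in
/-- The lattice of a product arrangement is the product of the lattices. -/
def prodLatticeIso : A.lattice × B.lattice ≃o (A.prod B).lattice :=
  RelIso.ofSurjective (OrderEmbedding.ofMapLEIff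
    (fun p => ⟨OrderDual.toDual ((OrderDual.ofDual p.1.1).prod (OrderDual.ofDual p.2.1)),
      Flats.prod p.1.2 p.2.2⟩) fun _ _ => submodule_prod_le_iff) (by
    rintro ⟨Z, hZ⟩
    obtain ⟨X, Y, hX, hY, h⟩ := Flats.exists_prod hZ
    exact ⟨(⟨_, hX⟩, ⟨_, hY⟩), Subtype.ext h⟩)

theorem moebius_prodLatticeIso (p : A.lattice × B.lattice) :
    (A.prod B).moebius (prodLatticeIso A B p) = A.moebius p.1 * B.moebius p.2 := by
  classical
  have h1 : prodLatticeIso A B (A.wholeSpace, B.wholeSpace) = (A.prod B).wholeSpace :=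
    Subtype.ext Submodule.prod_top
  rw [moebius, ← h1, mu_orderIso, ← IncidenceAlgebra.mu_prod_mu, IncidenceAlgebra.prod_apply]
  rfl

/-- The product of two subspaces as a subspace of the product. -/
def submoduleProdEquiv (G : Submodule K V) (H : Submodule K W) : (G × H) ≃ₗ[K] G.prod H where
  toFun x := ⟨(x.1, x.2), x.1.2, x.2.2⟩
  invFun x := (⟨x.1.1, x.2.1⟩, ⟨x.1.2, x.2.2⟩)
  map_add' _ _ := rfl
  map_smul' _ _ := rfl

theorem charPoly_prod [FiniteDimensional K V] [FiniteDimensional K W] :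
    (A.prod B).charPoly = A.charPoly * B.charPoly := by
  rw [charPoly, ← (prodLatticeIso A B).toEquiv.sum_comp, Fintype.sum_prod_type, charPoly, charPoly,
    Finset.sum_mul_sum]
  refine Finset.sum_congr rfl fun X _ => Finset.sum_congr rfl fun Y _ => ?_
  have h : finrank K ↥(OrderDual.ofDual (prodLatticeIso A B (X, Y)).1 : Submodule K (V × W)) =
      finrank K ↥(OrderDual.ofDual X.1) + finrank K ↥(OrderDual.ofDual Y.1) := by
    rw [← Module.finrank_prod]
    exact (submoduleProdEquiv (OrderDual.ofDual X.1) (OrderDual.ofDual Y.1)).symm.finrank_eq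
  change Polynomial.C ((A.prod B).moebius (prodLatticeIso A B (X, Y))) *
    Polynomial.X ^ finrank K ↥(OrderDual.ofDual (prodLatticeIso A B (X, Y)).1) = _
  rw [h, moebius_prodLatticeIso, Polynomial.C_mul, pow_add]
  ring

/-- Only `V` itself has full dimension, so the coefficient of that power is 1. This allows the
polynomial of a factor to be cancelled from a divisibility. -/
theorem charPoly_ne_zero [FiniteDimensional K V] (A : Arrangement K V) : A.charPoly ≠ 0 := by
  intro h0
  have h1 : A.charPoly.coeff (finrank K V) = 1 := by
    rw [charPoly, Polynomial.finsetSum_coeff, Finset.sum_eq_single A.wholeSpace]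
    · rw [Polynomial.coeff_C_mul_X_pow, if_pos, moebius, IncidenceAlgebra.mu_self]
      exact (finrank_top K V).symm
    · intro X _ hX
      rw [Polynomial.coeff_C_mul_X_pow, if_neg]
      intro h
      exact hX (Subtype.ext (Submodule.eq_top_of_finrank_eq (S := OrderDual.ofDual X.1) h.symm))
    · simp
  rw [h0, Polynomial.coeff_zero] at h1
  exact zero_ne_one h1

end CharPoly

/-! ### Stair-free products. -/

section StairFree

universe u w₁ w₂ w₃

variable {K : Type u} [Field K]

/-- Needed because the restriction of a product is a product only up to isomorphism; the two spaces
may lie in different universes. -/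
theorem StairFree.of_isMap {V : Type w₁} [AddCommGroup V] [Module K V] [hV : FiniteDimensional K V]
    {A : Arrangement K V} (hA : A.StairFree) {W : Type w₂} [AddCommGroup W] [Module K W]
    {e : V ≃ₗ[K] W} {B : Arrangement K W} (h : IsMap e A B) : B.StairFree := by
  induction hA generalizing hV W with
  | empty V =>
    rw [isMap_empty e.symm h.symm]
    exact StairFree.empty W
  | addition A H hH b c _ hexp' hexp'' ih =>
    obtain ⟨G, rfl⟩ : ∃ G, H = Submodule.comap e.toLinearMap G := ⟨_, (comap_symm_comap e H).symm⟩
    exact StairFree.addition B G ((h G).1 hH) b c (ih (h.deletion G))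
      ((h.deletion G).hasExponents hexp') ((h.restriction G).hasExponents hexp'')
  | division A H hH _ hdvd ih =>
    obtain ⟨G, rfl⟩ : ∃ G, H = Submodule.comap e.toLinearMap G := ⟨_, (comap_symm_comap e H).symm⟩
    refine StairFree.division B G ((h G).1 hH) (ih (h.restriction G)) ?_
    rwa [h.charPoly_eq, (h.restriction G).charPoly_eq]

variable {V : Type w₁} [AddCommGroup V] [Module K V] [hV : FiniteDimensional K V]
  {W : Type w₂} [AddCommGroup W] [Module K W] [hW : FiniteDimensional K W]
  {A : Arrangement K V} {B : Arrangement K W}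

theorem StairFree.prod_comm (h : (A.prod B).StairFree) : (B.prod A).StairFree :=
  h.of_isMap (isMap_prodComm A B)

/-- The addition step for the left factor of a product. -/
theorem StairFree.prod_addition {H : Submodule K V} (hH : H ∈ A.hyperplanes) {b e : Multiset ℕ}
    {c : ℕ} (h : ((A.deletion H).prod B).StairFree) (h' : (A.deletion H).HasExponents (c ::ₘ b))
    (h'' : (A.restriction H).HasExponents b) (hB : B.HasExponents e) : (A.prod B).StairFree := by
  refine StairFree.addition _ (H.prod ⊤) (prod_top_mem.2 hH) (b + e) c ?_ ?_ ?_
  · rwa [deletion_prod_left hH]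
  · rw [deletion_prod_left hH, ← Multiset.cons_add]
    exact h'.prod hB
  · exact (isMap_restriction_prod H).hasExponents (h''.prod hB)

/-- The division step for the left factor of a product. -/
theorem StairFree.prod_division {H : Submodule K V} (hH : H ∈ A.hyperplanes)
    (h : ((A.restriction H).prod B).StairFree) (hdvd : (A.restriction H).charPoly ∣ A.charPoly) :
    (A.prod B).StairFree := by
  refine StairFree.division _ (H.prod ⊤) (prod_top_mem.2 hH)
    (h.of_isMap (isMap_restriction_prod H)) ?_
  rw [(isMap_restriction_prod H).charPoly_eq, charPoly_prod, charPoly_prod]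
  exact mul_dvd_mul_right hdvd _

/-- The identity matrix satisfies Saito's criterion, the product of the forms being 1. -/
theorem hasExponents_empty (K : Type u) [Field K] (V : Type w₁) [AddCommGroup V] [Module K V]
    [FiniteDimensional K V] : ∃ e, (empty K V).HasExponents e := by
  classical
  let b := finBasis K V
  have hr := represents_normals b (empty K V)
  have hdet : Associated (1 : Matrix (Fin (finrank K V)) (Fin (finrank K V))
      (MvPolynomial (Fin (finrank K V)) K)).det (formProd (normals b (empty K V))) := by
    rw [Matrix.det_one, formProd]
    exact Associated.of_eq (Finset.prod_of_isEmpty (ι := (∅ : Finset (Submodule K V))) _).symm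
  exact ⟨_, hr.hasExponents_iff.2 <| (pairwiseIndep_normals _).hasDegrees_of_associated (d := 0)
    (fun _ => by
      rintro _ ⟨⟨H, hH⟩, -⟩
      exact absurd hH (Finset.notMem_empty H))
    (fun j k => by
      rw [Matrix.one_apply]
      split_ifs
      · exact MvPolynomial.isHomogeneous_one _ _
      · exact MvPolynomial.isHomogeneous_zero _ _ _) hdet⟩

theorem StairFree.empty_prod {B : Arrangement K W} (hB : B.StairFree) :
    ((Arrangement.empty K V).prod B).StairFree := by
  obtain ⟨e, he⟩ := hasExponents_empty K V
  induction hB generalizing hW with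
  | empty W =>
    rw [empty_prod_empty]
    exact StairFree.empty _
  | addition B H hH b c _ hexp' hexp'' ih =>
    exact (StairFree.prod_addition hH ih.prod_comm hexp' hexp'' he).prod_comm
  | division B H hH _ hdvd ih =>
    exact (StairFree.prod_division hH ih.prod_comm hdvd).prod_comm

/-- Double induction. An addition step in `A` needs exponents of `B`, which the addition theorem
provides only if `B` itself arose by addition. If `B` arose by division, that step is taken in the
product first, with `A` untouched. -/
theorem StairFree.prod (hA : A.StairFree) (hB : B.StairFree) : (A.prod B).StairFree := by
  induction hA generalizing hV W with
  | empty V => exact hB.empty_prod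
  | division A H hH _ hdvd ih => exact StairFree.prod_division hH (ih hB) hdvd
  | addition A H hH b c hA' hexp' hexp'' ih =>
    induction hB generalizing hW with
    | empty W =>
      obtain ⟨e, he⟩ := hasExponents_empty K W
      exact StairFree.prod_addition hH (ih (StairFree.empty W)) hexp' hexp'' he
    | division B G hG _ hdvd ihB => exact (StairFree.prod_division hG ihB.prod_comm hdvd).prod_comm
    | addition B G hG b' c' hB' hexpB' hexpB'' _ =>
      exact StairFree.prod_addition hH (ih (StairFree.addition B G hG b' c' hB' hexpB' hexpB''))
        hexp' hexp'' (HasExponents.addition hG hexpB' hexpB'')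

/-! ### Factors of stair-free products -/

/-- The exponents `r` of `B` are contained in those of both products. Cancelling them leaves exactly
the exponent pattern of an addition step for `A`. -/
theorem StairFree.of_prod_addition {H : Submodule K V} (hH : H ∈ A.hyperplanes) {b : Multiset ℕ}
    {c : ℕ} (hA : (A.deletion H).StairFree) (h' : ((A.deletion H).prod B).HasExponents (c ::ₘ b))
    (h'' : ((A.restriction H).prod B).HasExponents b) : A.StairFree := by
  obtain ⟨s, hs⟩ := h'.isFree.exists_hasExponents_left
  obtain ⟨t, ht⟩ := h''.isFree.exists_hasExponents_left
  obtain ⟨r, hr⟩ := h'.isFree.exists_hasExponents_right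
  have h1 : s + r = c ::ₘ b := (hs.prod hr).unique h'
  have h2 : t + r = b := (ht.prod hr).unique h''
  rw [← h2, ← Multiset.cons_add, add_left_inj] at h1
  exact StairFree.addition A H hH t c hA (h1 ▸ hs) ht

theorem StairFree.of_prod_division {H : Submodule K V} (hH : H ∈ A.hyperplanes)
    (hA : (A.restriction H).StairFree)
    (hdvd : ((A.restriction H).prod B).charPoly ∣ (A.prod B).charPoly) : A.StairFree := by
  refine StairFree.division A H hH hA ?_
  rw [charPoly_prod, charPoly_prod] at hdvd
  exact (mul_dvd_mul_iff_right B.charPoly_ne_zero).1 hdvd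

variable {U : Type w₃} [AddCommGroup U] [Module K U] {C : Arrangement K U}

/-- The induction runs over arrangements merely isomorphic to a product, since restrictions leave
the class of literal products. The hyperplane of each step lies in one factor; the other factor is
unchanged and handled by the induction hypothesis. -/
theorem StairFree.left_right_of_isMap (hC : C.StairFree) {e : (V × W) ≃ₗ[K] U}
    (h : IsMap e (A.prod B) C) : A.StairFree ∧ B.StairFree := by
  induction hC generalizing hV hW V W with
  | empty U =>
    obtain ⟨rfl, rfl⟩ := eq_empty_of_prod_eq_empty (isMap_empty e h)
    exact ⟨StairFree.empty V, StairFree.empty W⟩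
  | @addition U _ _ C H hH b c _ hexp' hexp'' ih =>
    have : FiniteDimensional K U := Module.Finite.equiv e
    rcases mem_prod.1 ((h H).2 hH) with ⟨G, hG, hGH⟩ | ⟨G, hG, hGH⟩
    · have hd := h.deletion_left hG hGH
      obtain ⟨f, hf⟩ := h.exists_restriction_left hGH
      obtain ⟨hA, hB⟩ := ih hd
      exact ⟨.of_prod_addition hG hA (hd.symm.hasExponents hexp') (hf.symm.hasExponents hexp''), hB⟩
    · have hd := h.deletion_right hG hGH
      obtain ⟨f, hf⟩ := h.exists_restriction_right hGH
      obtain ⟨hA, hB⟩ := ih hd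
      exact ⟨hA, .of_prod_addition hG hB
        ((isMap_prodComm _ _).hasExponents (hd.symm.hasExponents hexp'))
        ((isMap_prodComm _ _).hasExponents (hf.symm.hasExponents hexp''))⟩
  | division C H hH _ hdvd ih =>
    rw [h.charPoly_eq] at hdvd
    rcases mem_prod.1 ((h H).2 hH) with ⟨G, hG, hGH⟩ | ⟨G, hG, hGH⟩
    · obtain ⟨f, hf⟩ := h.exists_restriction_left hGH
      obtain ⟨hA, hB⟩ := ih hf
      rw [hf.charPoly_eq] at hdvd
      exact ⟨.of_prod_division hG hA hdvd, hB⟩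
    · obtain ⟨f, hf⟩ := h.exists_restriction_right hGH
      obtain ⟨hA, hB⟩ := ih hf
      rw [hf.charPoly_eq, ← (isMap_prodComm _ _).charPoly_eq, ← (isMap_prodComm A B).charPoly_eq]
        at hdvd
      exact ⟨hA, .of_prod_division hG hB hdvd⟩

end StairFree

/-! ### Additionally free products. -/

section AdditionallyFree

variable {K : Type*} [Field K] {V : Type*} [AddCommGroup V] [Module K V]
  {W : Type*} [AddCommGroup W] [Module K W]

theorem card_deletion {A : Arrangement K V} {H : Submodule K V} (hH : H ∈ A.hyperplanes) :
    A.hyperplanes.card = (A.deletion H).hyperplanes.card + 1 := by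
  classical
  exact (Finset.card_erase_add_one hH).symm

theorem AdditionallyFree.isFree {A : Arrangement K V} (hA : A.AdditionallyFree) : A.IsFree := by
  obtain ⟨F, -, hF, -, hfree⟩ := hA
  exact hF ▸ (hfree _ le_rfl).1

theorem AdditionallyFree.of_deletion {A : Arrangement K V} {H : Submodule K V}
    (hH : H ∈ A.hyperplanes) (hA : A.IsFree) (h : (A.deletion H).AdditionallyFree) :
    A.AdditionallyFree := by
  classical
  obtain ⟨F, h0, hF, hlt, hfree⟩ := h
  have hcard := card_deletion hH
  set n := (A.deletion H).hyperplanes.card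
  refine ⟨fun i => if i ≤ n then F i else A, by simpa using h0, by simp [hcard], ?_, ?_⟩
  · intro i hi
    rw [hcard] at hi
    rcases Nat.lt_succ_iff_lt_or_eq.1 hi with hi | rfl
    · simpa [hi.le, Nat.succ_le_iff.2 hi] using hlt i hi
    · simp only [le_refl, if_true, Nat.not_succ_le_self, if_false, hF]
      exact Finset.erase_ssubset hH
  · intro i hi
    dsimp only
    split_ifs with h
    · exact hfree i h
    · exact ⟨hA, by omega⟩

/-- Consecutive members of the chain differ by one hyperplane because of their cardinalities, so the
chain amounts to successive deletions through free arrangements. -/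
theorem AdditionallyFree.induction {P : Arrangement K V → Prop} (hempty : P (empty K V))
    (hadd : ∀ A : Arrangement K V, ∀ H ∈ A.hyperplanes, A.IsFree → P (A.deletion H) → P A)
    {A : Arrangement K V} (hA : A.AdditionallyFree) : P A := by
  classical
  obtain ⟨F, h0, hF, hlt, hfree⟩ := hA
  have key : ∀ i ≤ A.hyperplanes.card, P (F i) := by
    intro i
    induction i with
    | zero => exact fun _ => h0 ▸ hempty
    | succ i ih =>
      intro hi
      have hss := hlt i hi
      obtain ⟨H, hH, hHi⟩ := Finset.exists_of_ssubset hss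
      have heq : (F (i + 1)).deletion H = F i := by
        ext1
        refine (Finset.eq_of_subset_of_card_le ?_ ?_).symm
        · intro G hG
          exact Finset.mem_erase.2 ⟨fun h => hHi (h ▸ hG), hss.subset hG⟩
        · have h1 := card_deletion hH
          rw [(hfree _ hi).2] at h1
          rw [(hfree i (by omega)).2]
          omega
      exact hadd _ H hH (hfree _ hi).1 (heq ▸ ih (by omega))
  exact hF ▸ key _ le_rfl

variable [FiniteDimensional K V] [FiniteDimensional K W]

theorem isFree_empty : (empty K V).IsFree :=
  let ⟨_, h⟩ := hasExponents_empty K V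
  h.isFree

theorem additionallyFree_empty : (empty K V).AdditionallyFree :=
  ⟨fun _ => empty K V, rfl, rfl, fun i hi => by simp [empty] at hi, fun i hi => by
    obtain rfl : i = 0 := by simpa [empty] using hi
    exact ⟨isFree_empty, rfl⟩⟩

/-- The chain of `A` is run with the empty arrangement as second factor, then the chain of `B` with
`A` fixed; each stage is free as a product of free arrangements. -/
theorem AdditionallyFree.prod {A : Arrangement K V} {B : Arrangement K W}
    (hA : A.AdditionallyFree) (hB : B.AdditionallyFree) : (A.prod B).AdditionallyFree := by
  have h1 : (A.prod (empty K W)).AdditionallyFree := by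
    refine AdditionallyFree.induction (P := fun A => (A.prod (empty K W)).AdditionallyFree) ?_ ?_ hA
    · rw [empty_prod_empty]
      exact additionallyFree_empty
    · intro A H hH hfree h
      refine .of_deletion (prod_top_mem.2 hH) (isFree_prod_iff.2 ⟨hfree, isFree_empty⟩) ?_
      rwa [deletion_prod_left hH]
  refine AdditionallyFree.induction (P := fun B => (A.prod B).AdditionallyFree) h1 ?_ hB
  intro B H hH hfree h
  refine .of_deletion (top_prod_mem.2 hH) (isFree_prod_iff.2 ⟨hA.isFree, hfree⟩) ?_
  rwa [deletion_prod_right hH]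

/-- Each deletion along a chain of the product is a deletion in one factor, and freeness of the
product passes to both factors. -/
theorem AdditionallyFree.left_right {A : Arrangement K V} {B : Arrangement K W}
    (h : (A.prod B).AdditionallyFree) : A.AdditionallyFree ∧ B.AdditionallyFree := by
  refine AdditionallyFree.induction (P := fun C => ∀ (A : Arrangement K V) (B : Arrangement K W),
    A.prod B = C → A.AdditionallyFree ∧ B.AdditionallyFree) ?_ ?_ h A B rfl
  · intro A B h0
    obtain ⟨rfl, rfl⟩ := eq_empty_of_prod_eq_empty h0
    exact ⟨additionallyFree_empty, additionallyFree_empty⟩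
  · rintro _ H hH hfree ih A B rfl
    obtain ⟨hA, hB⟩ := isFree_prod_iff.1 hfree
    rcases mem_prod.1 hH with ⟨G, hG, rfl⟩ | ⟨G, hG, rfl⟩
    · obtain ⟨h1, h2⟩ := ih _ _ (deletion_prod_left hG).symm
      exact ⟨.of_deletion hG hA h1, h2⟩
    · obtain ⟨h1, h2⟩ := ih _ _ (deletion_prod_right hG).symm
      exact ⟨h1, .of_deletion hG hB h2⟩

end AdditionallyFree

end Arrangement

theorem proposition2p9 {K : Type*} [Field K]
    {V₁ : Type*} [AddCommGroup V₁] [Module K V₁] [FiniteDimensional K V₁]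
    {V₂ : Type*} [AddCommGroup V₂] [Module K V₂] [FiniteDimensional K V₂]
    (A₁ : Arrangement K V₁) (A₂ : Arrangement K V₂) :
    ((A₁.prod A₂).StairFree ↔ A₁.StairFree ∧ A₂.StairFree) ∧
      ((A₁.prod A₂).AdditionallyFree ↔ A₁.AdditionallyFree ∧ A₂.AdditionallyFree) :=
  ⟨⟨fun h => h.left_right_of_isMap (Arrangement.IsMap.refl _), fun h => h.1.prod h.2⟩,
    ⟨fun h => h.left_right, fun h => h.1.prod h.2⟩⟩

end
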